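/- Let $N, L \ge 1$, $m_1,\dots,m_N \ge 1$ be integers and $r_1,\dots,r_N > 0$. The unknown parameter is $p = (p_{i,\nu})_{1\le i\le m_\nu,\,1\le\nu\le N}$ with $p_{i,\nu} > 0$ and $p_{0,\nu} := 1 - \sum_{i=1}^{m_\nu} p_{i,\nu} > 0$; let $D$ be the set of all such $p$. One observes $X = (X_1,\dots,X_N)$, where $X_1,\dots,X_N$ are independent and $X_\nu$ has the negative multinomial mass function $$\frac{\Gamma(r_\nu + \sum_{i} x_{i,\nu})}{\Gamma(r_\nu)\prod_{i} x_{i,\nu}!}\, p_{0,\nu}^{r_\nu} \prod_{i=1}^{m_\nu} p_{i,\nu}^{x_{i,\nu}}, \qquad x_\nu \in \mathbb{N}_0^{m_\nu}.$$ For $\lambda = 1,\dots,L$ let $1 \le \nu^{(\lambda)}_1 < \dots < \nu^{(\lambda)}_{d^{(\lambda)}} \le N$ with $d^{(\lambda)} \ge 1$, let $l^{(\lambda)} \ge 1$ be an integer, and let $W^{(\lambda)}$ be a multinomial table with $l^{(\lambda)}$ trials and cells $(i_1,\dots,i_{d^{(\lambda)}})$, $0 \le i_h \le m_{\nu^{(\lambda)}_h}$,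 of probabilities $\prod_{h} p_{i_h,\nu_h^{(\lambda)}}$; the tables $W^{(1)},\dots,W^{(L)}$ are independent of each other and of $X$. Let $f(w\mid p)$ be the joint mass function of $W = (W^{(1)},\dots,W^{(L)})$. A predictive mass $\hat f$ assigns to every $x$ a probability mass function $\hat f(\cdot\,;x)$ on the range of $W$; its risk at $p$ is $E[\log\{f(W\mid p)/\hat f(W;X)\}] \in (-\infty,+\infty]$. A predictive mass dominates another if its risk is no larger at every $p\in D$ and strictly smaller at some $p \in D$; a predictive mass is inadmissible if some predictive mass dominates it. For a (possibly improper) prior density $\pi$ on $D$, the Bayesian predictive mass is the posterior mean $\hat f^{(\pi)}(w;x) = E_\pi[f(w\mid p)\mid X = x]$. Write $\Lambda(\nu) = \{\lambda : \nu \in \{\nu_1^{(\lambda)},\dots,\nu^{(\lambda)}_{d^{(\lambda)}}\}\}$. Suppose that for every $\nu = 1,\dots,N$ $$r_\nu \ge 1, \qquad r_\nu > \frac{m_\nu-1}{2} > \sum_{\lambda\in\Lambda(\nu)} l^{(\lambda)} .$$ Then the Bayesian predictive mass with respect to the Jeffreys prior for $X$ (the square root of the determinant of the Fisher information matrix), which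 is the same as the one with respect to the Dirichlet prior $$\pi(p) \propto \prod_{\nu=1}^N \Big( p_{0,\nu}^{a_{0,\nu}-1} \prod_{i=1}^{m_\nu} p_{i,\nu}^{a_{i,\nu}-1}\Big), \qquad a_{0,\nu} = \tfrac{1-m_\nu}{2},\quad a_{i,\nu} = \tfrac12,$$ is inadmissible. Moreover, there are $\alpha > 0$, $\beta > 0$ and $\gamma \in (0,\infty)^N$ such that it is dominated by the Bayesian predictive mass with respect to the prior $$\pi_{\alpha,\beta,\gamma}(p) = \int_0^\infty u^{\alpha-1} e^{-\beta u} \prod_{\nu=1}^N \Big( p_{0,\nu}^{\gamma_\nu u + a_{0,\nu}-1} \prod_{i=1}^{m_\nu} p_{i,\nu}^{a_{i,\nu}-1}\Big)\,du$$ with the same $a_{0,\nu}$ and $a_{i,\nu}$. -/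

import Mathlib

open scoped ENNReal Nat BigOperators

namespace NegMultin

/-- Parameters `p = (p_{i,ν})`, with `1 ≤ i ≤ m ν` for each `ν`. -/
abbrev Param {N : ℕ} (m : Fin N → ℕ) : Type := (ν : Fin N) → Fin (m ν) → ℝ

/-- Observations `x = (x_{i,ν})` of the `N` negative multinomial vectors. -/
abbrev Obs {N : ℕ} (m : Fin N → ℕ) : Type := (ν : Fin N) → Fin (m ν) → ℕ

/-- `p_0 = 1 - p_1 - ⋯ - p_k`. -/
def zeroProb {k : ℕ} (q : Fin k → ℝ) : ℝ := 1 - ∑ i, q i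

/-- The full probability vector `(p_0, p_1, …, p_k)`. -/
def fullProb {k : ℕ} (q : Fin k → ℝ) : Fin (k + 1) → ℝ :=
  Fin.cons (α := fun _ => ℝ) (zeroProb q) q

/-- The parameter space `D = D_{m_1} × ⋯ × D_{m_N}`. -/
def paramSpace {N : ℕ} (m : Fin N → ℕ) : Set (Param m) :=
  {p | ∀ ν, (∀ i, 0 < p ν i) ∧ ∑ i, p ν i < 1}

/-- Mass function of one negative multinomial vector. -/
noncomputable def negMultinMass {k : ℕ} (r : ℝ) (q : Fin k → ℝ) (x : Fin k → ℕ) : ℝ :=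
  Real.Gamma (r + ∑ i, (x i : ℝ)) / (Real.Gamma r * ∏ i, ((x i)! : ℝ))
    * zeroProb q ^ r * ∏ i, q i ^ x i

/-- Joint mass function of the independent negative multinomial vectors `X_1, …, X_N`. -/
noncomputable def obsMass {N : ℕ} {m : Fin N → ℕ} (r : Fin N → ℝ) (p : Param m) (x : Obs m) : ℝ :=
  ∏ ν, negMultinMass (r ν) (p ν) (x ν)

section Tables

variable {N L : ℕ}

/-- The cells `I_0^{(t)}` of table `t`: multi-indices `(i_h)_h` with `0 ≤ i_h ≤ m (idx t h)`. -/
abbrev Cell (m : Fin N → ℕ) {d : Fin L → ℕ} (idx : (t : Fin L) → Fin (d t) → Fin N)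
    (t : Fin L) : Type :=
  (h : Fin (d t)) → Fin (m (idx t h) + 1)

/-- The set `𝒲 = 𝒲^{(1)} × ⋯ × 𝒲^{(L)}` of tuples of tables, table `t` having total count `l t`. -/
abbrev Tables (m : Fin N → ℕ) {d : Fin L → ℕ} (idx : (t : Fin L) → Fin (d t) → Fin N)
    (l : Fin L → ℕ) : Type :=
  (t : Fin L) → {w : Cell m idx t → ℕ // ∑ i, w i = l t}

/-- Probability of cell `i` of table `t`, the product of the corresponding elements of
the probability vectors attached to the table. -/
noncomputable def cellProb {m : Fin N → ℕ} {d : Fin L → ℕ}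
    (idx : (t : Fin L) → Fin (d t) → Fin N) (p : Param m) (t : Fin L) (i : Cell m idx t) : ℝ :=
  ∏ h, fullProb (p (idx t h)) (i h)

/-- Joint mass function `f(w | p)` of the independent multinomial tables `W^{(1)}, …, W^{(L)}`. -/
noncomputable def tableMass {m : Fin N → ℕ} {d : Fin L → ℕ}
    (idx : (t : Fin L) → Fin (d t) → Fin N) (l : Fin L → ℕ) (p : Param m)
    (w : Tables m idx l) : ℝ :=
  ∏ t, ((l t)! : ℝ) / (∏ i, (((w t).1 i)! : ℝ)) * ∏ i, cellProb idx p t i ^ (w t).1 i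

/-- `Λ(ν)`: the tables to which the `ν`-th probability vector is attached. -/
def tablesAt {d : Fin L → ℕ} (idx : (t : Fin L) → Fin (d t) → Fin N) (ν : Fin N) :
    Finset (Fin L) :=
  Finset.univ.filter fun t => ∃ h, idx t h = ν

variable {m : Fin N → ℕ} {d : Fin L → ℕ} {idx : (t : Fin L) → Fin (d t) → Fin N} {l : Fin L → ℕ}

/-- `g x w` is the estimated mass at `w` when `x` is observed; for each `x` it has to be a
probability mass function in `w`. -/
def IsPredictiveMass (g : Obs m → Tables m idx l → ℝ≥0∞) : Prop :=
  ∀ x, ∑' w, g x w = 1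

/-- `log (f(w | p) / g(w; x))`, equal to `+∞` where the estimated mass vanishes. -/
noncomputable def logLoss (g : Obs m → Tables m idx l → ℝ≥0∞) (p : Param m) (x : Obs m)
    (w : Tables m idx l) : EReal :=
  ENNReal.log (ENNReal.ofReal (tableMass idx l p w) / g x w)

/-- The Kullback-Leibler risk `E[log (f(W | p) / g(W; X))]`, where `X` and `W` are independent:
the expectation of the positive part minus that of the negative part. -/
noncomputable def risk (r : Fin N → ℝ) (g : Obs m → Tables m idx l → ℝ≥0∞) (p : Param m) : EReal :=
  ((∑' z : Obs m × Tables m idx l,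
      ENNReal.ofReal (obsMass r p z.1 * tableMass idx l p z.2)
        * (logLoss g p z.1 z.2).toENNReal : ℝ≥0∞) : EReal)
  - ((∑' z : Obs m × Tables m idx l,
      ENNReal.ofReal (obsMass r p z.1 * tableMass idx l p z.2)
        * (-logLoss g p z.1 z.2).toENNReal : ℝ≥0∞) : EReal)

/-- `g` dominates `f`: its risk is nowhere larger and somewhere strictly smaller. -/
def Dominates (r : Fin N → ℝ) (g f : Obs m → Tables m idx l → ℝ≥0∞) : Prop :=
  (∀ p ∈ paramSpace m, risk r g p ≤ risk r f p) ∧ ∃ p ∈ paramSpace m, risk r g p < risk r f p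

/-- An inadmissible predictive mass is one dominated by some other predictive mass. -/
def Inadmissible (r : Fin N → ℝ) (f : Obs m → Tables m idx l → ℝ≥0∞) : Prop :=
  IsPredictiveMass f ∧ ∃ g : Obs m → Tables m idx l → ℝ≥0∞, IsPredictiveMass g ∧ Dominates r g f

/-- The Bayesian predictive mass `E_π[f(w | p) | X = x]` for a (possibly improper, not
necessarily normalized) prior density `π` on `D`. -/
noncomputable def bayesMass (r : Fin N → ℝ) (idx : (t : Fin L) → Fin (d t) → Fin N)
    (l : Fin L → ℕ) (π : Param m → ℝ≥0∞) (x : Obs m) (w : Tables m idx l) : ℝ≥0∞ :=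
  (∫⁻ p in paramSpace m,
      π p * ENNReal.ofReal (obsMass r p x) * ENNReal.ofReal (tableMass idx l p w))
    / ∫⁻ p in paramSpace m, π p * ENNReal.ofReal (obsMass r p x)

end Tables

section Priors

variable {N : ℕ} {m : Fin N → ℕ}

/-- The kernel `∏_ν (p_{0,ν}^{a_{0,ν} - 1} ∏_i p_{i,ν}^{a_{i,ν} - 1})`. -/
noncomputable def dirichletKernel (a₀ : Fin N → ℝ) (a : Param m) (p : Param m) : ℝ :=
  ∏ ν, (zeroProb (p ν) ^ (a₀ ν - 1) * ∏ i, p ν i ^ (a ν i - 1))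

/-- The (unnormalized) Dirichlet prior. -/
noncomputable def dirichletPrior (a₀ : Fin N → ℝ) (a : Param m) (p : Param m) : ℝ≥0∞ :=
  ENNReal.ofReal (dirichletKernel a₀ a p)

/-- The hierarchical shrinkage prior, a mixture over `u` of Dirichlet kernels. -/
noncomputable def shrinkagePrior (α β : ℝ) (γ : Fin N → ℝ) (a₀ : Fin N → ℝ) (a : Param m)
    (p : Param m) : ℝ≥0∞ :=
  ∫⁻ u in Set.Ioi (0 : ℝ), ENNReal.ofReal
    (u ^ (α - 1) * Real.exp (-(β * u)) * dirichletKernel (fun ν => γ ν * u + a₀ ν) a p)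

/-- The score `∂/∂p_{i,ν} log P(X = x | p)` for `j = (ν, i)`. -/
noncomputable def score (r : Fin N → ℝ) (p : Param m) (x : Obs m) (j : (ν : Fin N) × Fin (m ν)) :
    ℝ :=
  deriv (fun s : ℝ => Real.log
    (obsMass r (Function.update p j.1 (Function.update (p j.1) j.2 s)) x)) (p j.1 j.2)

/-- The Fisher information matrix of the observation `X`, the second-moment matrix of the score. -/
noncomputable def fisherInfo (r : Fin N → ℝ) (p : Param m) :
    Matrix ((ν : Fin N) × Fin (m ν)) ((ν : Fin N) × Fin (m ν)) ℝ :=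
  Matrix.of fun j k => ∑' x : Obs m, obsMass r p x * (score r p x j * score r p x k)

/-- The (unnormalized) Jeffreys prior `√(det I(p))`. -/
noncomputable def jeffreysPrior (r : Fin N → ℝ) (p : Param m) : ℝ≥0∞ :=
  ENNReal.ofReal (Real.sqrt (fisherInfo r p).det)

end Priors

end NegMultin

/-! Conjugacy reduces everything to Gamma functions. For `α = 1` and `γ = 1` the shrinkage prior
mixes, with weight `exp (-β u)`, Dirichlet kernels whose zero-cell parameter is raised by `u`; the
Jeffreys prior is the kernel at `u = 0`. Given `u`, the predictive mass at `w` depends on `w`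
through the exponents `c = expo w`, and its ratio to the mass at `u = 0` is a product of ratios of
rising factorials. Write `n = trials`, `A = (1 - m) / 2 + r`, `a = A + n - 1`, `t = total x` and `T
= postSum = r + t + 1/2`. Elementary bounds give a log-ratio of at least the sum over `ν` of `c₀ u /
(a + u) - n u / T` (`marginal_ratio_le`), and Jensen's inequality over the posterior of `u` carries
this bound to the mixture (`marginal_ratio_mul_exp_le`).

Averaging over `w` replaces `c₀` by its mean `n p₀`. The risk difference is thus at least the sum
over `ν` of `n E[p₀ F(X) - M₁(X) / T]`, where `F` and `M₁` are the posterior means of `u / (a + u)`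
and `u`. Since `p₀ = 1 - ∑ pᵢ`, the unknown `p` is removed by the identity `E[pᵢ ψ(X + eᵢ)] = E[Xᵢ /
(r + t - 1) ψ(X)]` (`hasSum_mul_bump_iff`), applied to the function `prevMean` whose value at `x +
eᵢ` is `F(x)` for every `i`.

It remains to see that the resulting estimate is positive at every `x` (`gain_estimate_pos`). With
`M₂` the posterior mean of `u²`, it is at least `[((r - 1) / a - 1) M₁ - ((r - 1) / a² + 1 / a) M₂]
/ (r + t - 1)`, and `M₂ ≤ (2 / β) M₁` because the marginal mass decreases in `u`. So a large `β`
suffices as soon as `r - 1 > a`, which is exactly `n < (m - 1) / 2`. Vectors attached to no table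
contribute nothing, and for the others `r > 1` follows from the hypotheses. The improvement is
strict at every `p`.

Besides this, the determinant of the Fisher information is needed to identify the Jeffreys prior,
and integrability of the log losses is needed to subtract the risks. -/

namespace NegMultin

open MeasureTheory

/-! ### Product integrals and the Dirichlet integral -/

/-- Tonelli's theorem for a product of functions of the separate coordinates. -/
theorem lintegral_pi_prod {n : ℕ} {E : Fin n → Type*} [∀ i, MeasureSpace (E i)]
    [∀ i, SigmaFinite (volume : Measure (E i))] (f : (i : Fin n) → E i → ℝ≥0∞)
    (hf : ∀ i, Measurable (f i)) :
    ∫⁻ x : (i : Fin n) → E i, ∏ i, f i (x i) = ∏ i, ∫⁻ x, f i x := by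
  induction n with
  | zero => simp [volume_pi]
  | succ n ih =>
    rw [← ((volume_preserving_piFinSuccAbove E 0).symm).lintegral_comp_emb
      (MeasurableEquiv.measurableEmbedding _)]
    have : ∀ a : E 0 × ((i : Fin n) → E i.succ),
        ∏ i, f i ((MeasurableEquiv.piFinSuccAbove E 0).symm a i)
          = f 0 a.1 * ∏ i : Fin n, f i.succ (a.2 i) := by
      intro a
      rw [Fin.prod_univ_succ]
      rfl
    refine (lintegral_congr this).trans ?_
    rw [Fin.prod_univ_succ, ← ih (fun i => f i.succ) fun i => hf _]
    have : SigmaFinite (volume : Measure ((i : Fin n) → E i.succ)) :=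
      Measure.pi.sigmaFinite fun i : Fin n => (volume : Measure (E i.succ))
    exact lintegral_prod_mul (μ := (volume : Measure (E 0)))
      (ν := (volume : Measure ((i : Fin n) → E i.succ))) (f := f 0)
      (g := fun y : (i : Fin n) → E i.succ => ∏ i : Fin n, f i.succ (y i)) (hf 0).aemeasurable
      (Finset.measurable_prod _ fun i _ => (hf _).comp (measurable_pi_apply i)).aemeasurable

/-- Summation of a product of functions of the separate coordinates. -/
theorem tsum_pi_prod {n : ℕ} {E : Fin n → Type*} (f : (i : Fin n) → E i → ℝ≥0∞) :
    ∑' x : (i : Fin n) → E i, ∏ i, f i (x i) = ∏ i, ∑' x, f i x := by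
  induction n with
  | zero => simp
  | succ n ih =>
    rw [← (Fin.consEquiv E).tsum_eq, ENNReal.tsum_prod', Fin.prod_univ_succ,
      ← ih (fun i => f i.succ), ← ENNReal.tsum_mul_right]
    congr 1 with a
    rw [← ENNReal.tsum_mul_left]
    congr 1 with y
    simp [Fin.prod_univ_succ, Fin.consEquiv]

/-- The power `t ^ (b - 1)` on the positive half-line, extended by zero. -/
noncomputable def posPow (b t : ℝ) : ℝ≥0∞ := if 0 < t then ENNReal.ofReal (t ^ (b - 1)) else 0

theorem measurable_posPow (b : ℝ) : Measurable (posPow b) :=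
  Measurable.ite measurableSet_Ioi (by fun_prop) measurable_const

theorem posPow_of_pos {b t : ℝ} (ht : 0 < t) : posPow b t = ENNReal.ofReal (t ^ (b - 1)) :=
  if_pos ht

theorem posPow_of_nonpos {b t : ℝ} (ht : t ≤ 0) : posPow b t = 0 := if_neg ht.not_gt

theorem posPow_mul {b c t : ℝ} (hc : 0 < c) :
    posPow b (c * t) = ENNReal.ofReal (c ^ (b - 1)) * posPow b t := by
  rcases le_or_gt t 0 with ht | ht
  · rw [posPow_of_nonpos ht, posPow_of_nonpos (mul_nonpos_of_nonneg_of_nonpos hc.le ht), mul_zero]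
  · rw [posPow_of_pos ht, posPow_of_pos (mul_pos hc ht), Real.mul_rpow hc.le ht.le,
      ENNReal.ofReal_mul (by positivity)]

/-- The beta integral. -/
theorem lintegral_posPow_mul {b c : ℝ} (hb : 0 < b) (hc : 0 < c) (R : ℝ) :
    ∫⁻ s, posPow b s * posPow c (R - s)
      = ENNReal.ofReal (ProbabilityTheory.beta b c) * posPow (b + c) R := by
  rcases le_or_gt R 0 with hR | hR
  · rw [posPow_of_nonpos hR, mul_zero, ← lintegral_zero (μ := (volume : Measure ℝ))]
    congr 1 with s
    rcases le_or_gt s 0 with hs | hs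
    · rw [posPow_of_nonpos hs, zero_mul]
    · rw [posPow_of_nonpos (t := R - s) (by linarith), mul_zero]
  have h1 : ∫⁻ s, posPow b s * posPow c (1 - s) = ENNReal.ofReal (ProbabilityTheory.beta b c) := by
    have hB := ProbabilityTheory.beta_pos hb hc
    rw [← mul_one (ENNReal.ofReal _), ← ProbabilityTheory.lintegral_betaPDF_eq_one hb hc,
      ← lintegral_const_mul' _ _ ENNReal.ofReal_ne_top]
    congr 1 with s
    rw [ProbabilityTheory.betaPDF_eq]
    split_ifs with h
    · rw [posPow_of_pos h.1, posPow_of_pos (by linarith),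
        ← ENNReal.ofReal_mul (Real.rpow_nonneg h.1.le _), ← ENNReal.ofReal_mul hB.le]
      congr 1
      field_simp
    · rw [ENNReal.ofReal_zero, mul_zero]
      rcases le_or_gt s 0 with hs | hs
      · rw [posPow_of_nonpos hs, zero_mul]
      · rw [posPow_of_nonpos (t := 1 - s) (by by_contra h'; exact h ⟨hs, by linarith⟩), mul_zero]
  have hm := fun c => measurable_posPow c
  have h3 : ∀ s, posPow b (R * s) * posPow c (R - R * s)
      = ENNReal.ofReal (R ^ (b + c - 2)) * (posPow b s * posPow c (1 - s)) := by
    intro s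
    rw [show R - R * s = R * (1 - s) by ring, posPow_mul hR, posPow_mul hR,
      mul_mul_mul_comm, ← ENNReal.ofReal_mul (by positivity), ← Real.rpow_add hR]
    ring_nf
  -- The substitution `s ↦ R * s`, with Jacobian `R`, reduces to the case `R = 1`.
  rw [← Real.smul_map_volume_mul_left hR.ne', lintegral_smul_measure,
    lintegral_map (by fun_prop) (by fun_prop)]
  simp_rw [h3]
  rw [lintegral_const_mul' _ _ ENNReal.ofReal_ne_top, h1, posPow_of_pos hR,
    show b + c - 1 = 1 + (b + c - 2) by ring, Real.rpow_add hR, Real.rpow_one,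
    ENNReal.ofReal_mul hR.le, abs_of_pos hR, smul_eq_mul]
  ring

/-- The Dirichlet integral over the simplex of size `R`. -/
theorem lintegral_posPow_simplex {k : ℕ} {b₀ : ℝ} (hb₀ : 0 < b₀) (b : Fin k → ℝ)
    (hb : ∀ i, 0 < b i) (R : ℝ) :
    ∫⁻ q : Fin k → ℝ, posPow b₀ (R - ∑ i, q i) * ∏ i, posPow (b i) (q i)
      = ENNReal.ofReal (Real.Gamma b₀ * (∏ i, Real.Gamma (b i)) / Real.Gamma (b₀ + ∑ i, b i))
        * posPow (b₀ + ∑ i, b i) R := by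
  -- The size has to vary: when the first coordinate is `s`, the others range over a simplex of size
  -- `R - s`, and the integral over `s` that remains is a beta integral.
  induction k generalizing R with
  | zero => simp [volume_pi, div_self (Real.Gamma_pos_of_pos hb₀).ne']
  | succ k ih =>
    have hS : 0 ≤ ∑ i : Fin k, b i.succ := Finset.sum_nonneg fun i _ => (hb _).le
    rw [← ((volume_preserving_piFinSuccAbove (fun _ : Fin (k + 1) => ℝ) 0).symm).lintegral_comp_emb
      (MeasurableEquiv.measurableEmbedding _)]
    have : ∀ a : ℝ × (Fin k → ℝ),
        posPow b₀ (R - ∑ i, (MeasurableEquiv.piFinSuccAbove (fun _ => ℝ) 0).symm a i)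
          * ∏ i, posPow (b i) ((MeasurableEquiv.piFinSuccAbove (fun _ => ℝ) 0).symm a i)
          = posPow (b 0) a.1 * (posPow b₀ (R - a.1 - ∑ i, a.2 i)
            * ∏ i : Fin k, posPow (b i.succ) (a.2 i)) := by
      intro a
      rw [Fin.prod_univ_succ, Fin.sum_univ_succ, mul_left_comm, ← sub_sub]
      rfl
    simp_rw [this]
    have hm := fun c => measurable_posPow c
    rw [Measure.volume_eq_prod, lintegral_prod _ (by fun_prop)]
    have hin : ∀ s : ℝ, ∫⁻ y : Fin k → ℝ, posPow (b 0) s * (posPow b₀ (R - s - ∑ i, y i)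
        * ∏ i : Fin k, posPow (b i.succ) (y i))
        = ENNReal.ofReal (Real.Gamma b₀ * (∏ i : Fin k, Real.Gamma (b i.succ))
          / Real.Gamma (b₀ + ∑ i : Fin k, b i.succ))
          * (posPow (b 0) s * posPow (b₀ + ∑ i : Fin k, b i.succ) (R - s)) := by
      intro s
      rw [lintegral_const_mul _ (by fun_prop), ih _ (fun i => hb _), mul_left_comm]
    simp_rw [hin]
    rw [lintegral_const_mul' _ _ ENNReal.ofReal_ne_top,
      lintegral_posPow_mul (hb 0) (by linarith), ← mul_assoc]
    have hG := (Real.Gamma_pos_of_pos hb₀).le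
    have hG' : 0 ≤ ∏ i : Fin k, Real.Gamma (b i.succ) :=
      Finset.prod_nonneg fun i _ => (Real.Gamma_pos_of_pos (hb _)).le
    have hG2 := Real.Gamma_pos_of_pos (show 0 < b₀ + ∑ i : Fin k, b i.succ by linarith)
    rw [← ENNReal.ofReal_mul (by positivity), Fin.sum_univ_succ, Fin.prod_univ_succ,
      ProbabilityTheory.beta,
      show b 0 + (b₀ + ∑ i : Fin k, b i.succ) = b₀ + (b 0 + ∑ i : Fin k, b i.succ) by ring]
    congr 2
    field_simp

/-! ### Multinomial tables: exponents, generating function and means -/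

noncomputable instance fintypeFixedSum {ι : Type*} [Fintype ι] [DecidableEq ι] (n : ℕ) :
    Fintype {w : ι → ℕ // ∑ i, w i = n} :=
  Fintype.subtype (Finset.piAntidiag Finset.univ n) (by simp)

/-- The multinomial theorem, summing over the tables with a fixed total. -/
theorem sum_multinomial {ι : Type*} [Fintype ι] [DecidableEq ι] (n : ℕ) (f : ι → ℝ) :
    ∑ w : {w : ι → ℕ // ∑ i, w i = n}, ((n ! : ℕ) : ℝ) / (∏ i, ((w.1 i)! : ℝ)) * ∏ i, f i ^ w.1 i
      = (∑ i, f i) ^ n := by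
  rw [Finset.sum_pow_eq_sum_piAntidiag, ← Finset.sum_subtype (Finset.piAntidiag Finset.univ n)
    (p := fun w : ι → ℕ => ∑ i, w i = n) (by simp)
    (fun w => ((n ! : ℕ) : ℝ) / (∏ i, ((w i)! : ℝ)) * ∏ i, f i ^ w i)]
  refine Finset.sum_congr rfl fun w hw => ?_
  have h := Nat.multinomial_spec Finset.univ w
  rw [(Finset.mem_piAntidiag.1 hw).1] at h
  congr 1
  rw [← h]
  push_cast
  exact mul_div_cancel_left₀ _ (Finset.prod_ne_zero_iff.2 fun i _ => by positivity)

section Tables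

variable {N L : ℕ} {m : Fin N → ℕ} {d : Fin L → ℕ} {idx : (t : Fin L) → Fin (d t) → Fin N}
  {l : Fin L → ℕ}

/-- The exponent of the `j`-th element of the `ν`-th probability vector in the mass of `w`. -/
def expo (w : Tables m idx l) (ν : Fin N) (j : Fin (m ν + 1)) : ℕ :=
  ∑ t, ∑ i, (w t).1 i * (Finset.univ.filter fun h =>
    (⟨idx t h, i h⟩ : (ν : Fin N) × Fin (m ν + 1)) = ⟨ν, j⟩).card

/-- The product of the multinomial coefficients of `w`. -/
noncomputable def tableCoef (w : Tables m idx l) : ℝ :=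
  ∏ t, ((l t)! : ℝ) / (∏ i, (((w t).1 i)! : ℝ))

/-- The number of trials to which the `ν`-th probability vector is attached. -/
def trials (idx : (t : Fin L) → Fin (d t) → Fin N) (l : Fin L → ℕ) (ν : Fin N) : ℕ :=
  ∑ t ∈ tablesAt idx ν, l t

theorem tableCoef_pos (w : Tables m idx l) : 0 < tableCoef w :=
  Finset.prod_pos fun t _ => div_pos (by positivity) (Finset.prod_pos fun i _ => by positivity)

/-- Regroups the factors by vector and outcome. A general `F` in place of the probabilities allows
one outcome to be marked by a dummy variable. -/
theorem prod_cells_eq (F : (ν : Fin N) → Fin (m ν + 1) → ℝ) (w : Tables m idx l) :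
    ∏ t, ∏ i : Cell m idx t, (∏ h, F (idx t h) (i h)) ^ (w t).1 i
      = ∏ ν, ∏ j, F ν j ^ expo w ν j := by
  have h1 : ∀ t (i : Cell m idx t), (∏ h, F (idx t h) (i h)) ^ (w t).1 i
      = ∏ s : (ν : Fin N) × Fin (m ν + 1), F s.1 s.2 ^ ((w t).1 i * (Finset.univ.filter fun h =>
        (⟨idx t h, i h⟩ : (ν : Fin N) × Fin (m ν + 1)) = s).card) := by
    intro t i
    simp_rw [mul_comm ((w t).1 i), pow_mul, Finset.prod_pow]
    congr 1
    rw [← Finset.prod_fiberwise' Finset.univ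
      (fun h => (⟨idx t h, i h⟩ : (ν : Fin N) × Fin (m ν + 1))) fun s => F s.1 s.2]
    exact Finset.prod_congr rfl fun s _ => by rw [Finset.prod_const]
  simp_rw [h1, expo]
  rw [← Fintype.prod_sigma' (fun ν j => F ν j ^ _)]
  simp_rw [← Finset.prod_pow_eq_pow_sum]
  rw [Finset.prod_comm]
  refine Finset.prod_congr rfl fun t _ => ?_
  rw [Finset.prod_comm]

theorem tableMass_eq (p : Param m) (w : Tables m idx l) :
    tableMass idx l p w = tableCoef w * ∏ ν, ∏ j, fullProb (p ν) j ^ expo w ν j := by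
  rw [← prod_cells_eq (fun ν => fullProb (p ν)), tableCoef, ← Finset.prod_mul_distrib]
  rfl

/-- Strict monotonicity attaches a vector at most once to a table. This is why the exponents of one
vector sum to its number of trials. -/
theorem card_filter_idx (hidx : ∀ t, StrictMono (idx t)) (t : Fin L) (ν : Fin N) :
    (Finset.univ.filter fun h => idx t h = ν).card = if t ∈ tablesAt idx ν then 1 else 0 := by
  split_ifs with h
  · obtain ⟨h0, rfl⟩ := (Finset.mem_filter.1 h).2
    rw [Finset.card_eq_one]
    exact ⟨h0, by ext x; simp [(hidx t).injective.eq_iff]⟩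
  · rw [Finset.card_eq_zero, Finset.filter_eq_empty_iff]
    intro x _ hx
    exact h (Finset.mem_filter.2 ⟨Finset.mem_univ _, x, hx⟩)

theorem sum_expo (hidx : ∀ t, StrictMono (idx t)) (w : Tables m idx l) (ν : Fin N) :
    ∑ j, expo w ν j = trials idx l ν := by
  have h1 : ∀ t (i : Cell m idx t), ∑ j, (Finset.univ.filter fun h =>
      (⟨idx t h, i h⟩ : (ν : Fin N) × Fin (m ν + 1)) = ⟨ν, j⟩).card
      = (Finset.univ.filter fun h => idx t h = ν).card := by
    intro t i
    simp_rw [Finset.card_filter]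
    rw [Finset.sum_comm]
    refine Finset.sum_congr rfl fun h _ => ?_
    by_cases hν : idx t h = ν
    · subst hν
      simp
    · rw [if_neg hν]
      refine Finset.sum_eq_zero fun j _ => if_neg fun hj => hν (congrArg Sigma.fst hj)
  simp_rw [expo]
  rw [Finset.sum_comm]
  simp_rw [Finset.sum_comm (s := Finset.univ (α := Fin (m ν + 1))), ← Finset.mul_sum, h1,
    card_filter_idx hidx, ← Finset.sum_mul, (w _).2]
  simp [trials]

/-- The generating function of the exponents. -/
theorem sum_tableCoef_mul (hidx : ∀ t, StrictMono (idx t)) (F : (ν : Fin N) → Fin (m ν + 1) → ℝ) :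
    ∑ w : Tables m idx l, tableCoef w * ∏ ν, ∏ j, F ν j ^ expo w ν j
      = ∏ ν, (∑ j, F ν j) ^ trials idx l ν := by
  have h1 : ∀ w : Tables m idx l, tableCoef w * ∏ ν, ∏ j, F ν j ^ expo w ν j
      = ∏ t, (((l t)! : ℝ) / (∏ i, (((w t).1 i)! : ℝ))
        * ∏ i : Cell m idx t, (∏ h, F (idx t h) (i h)) ^ (w t).1 i) := by
    intro w
    rw [← prod_cells_eq, tableCoef, ← Finset.prod_mul_distrib]
  simp_rw [h1]
  rw [← Fintype.piFinset_univ, ← Finset.prod_univ_sum (fun _ => Finset.univ)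
    (fun t (w : {w : Cell m idx t → ℕ // ∑ i, w i = l t}) => ((l t)! : ℝ) / (∏ i, ((w.1 i)! : ℝ))
      * ∏ i : Cell m idx t, (∏ h, F (idx t h) (i h)) ^ w.1 i)]
  have h2 : ∀ t, ∏ h, ∑ j, F (idx t h) j
      = ∏ ν, (∑ j, F ν j) ^ (if t ∈ tablesAt idx ν then 1 else 0) := by
    intro t
    rw [← Finset.prod_fiberwise' Finset.univ (idx t) fun ν => ∑ j, F ν j]
    exact Finset.prod_congr rfl fun ν _ => by rw [Finset.prod_const, card_filter_idx hidx]
  simp_rw [sum_multinomial]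
  have h3 : ∀ t, ∑ i : Cell m idx t, ∏ h, F (idx t h) (i h) = ∏ h, ∑ j, F (idx t h) j := by
    intro t
    rw [Finset.prod_univ_sum, Fintype.piFinset_univ]
  simp_rw [h3, h2, ← Finset.prod_pow, ← pow_mul]
  rw [Finset.prod_comm]
  refine Finset.prod_congr rfl fun ν _ => ?_
  rw [Finset.prod_pow_eq_pow_sum]
  simp [trials]

theorem sum_fullProb {k : ℕ} (q : Fin k → ℝ) : ∑ j, fullProb q j = 1 := by
  simp [fullProb, Fin.sum_univ_succ, zeroProb]

theorem fullProb_pos {p : Param m} (hp : p ∈ paramSpace m) (ν : Fin N) (j : Fin (m ν + 1)) :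
    0 < fullProb (p ν) j := by
  refine Fin.cases ?_ (fun i => ?_) j
  · simpa [fullProb, zeroProb] using (hp ν).2
  · simpa [fullProb] using (hp ν).1 i

theorem zeroProb_pos {p : Param m} (hp : p ∈ paramSpace m) (ν : Fin N) : 0 < zeroProb (p ν) :=
  fullProb_pos hp ν 0

theorem tableMass_pos {p : Param m} (hp : p ∈ paramSpace m) (w : Tables m idx l) :
    0 < tableMass idx l p w := by
  rw [tableMass_eq]
  exact mul_pos (tableCoef_pos w) (Finset.prod_pos fun ν _ => Finset.prod_pos fun j _ =>
    pow_pos (fullProb_pos hp ν j) _)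

theorem sum_tableMass (hidx : ∀ t, StrictMono (idx t)) (p : Param m) :
    ∑ w, tableMass idx l p w = 1 := by
  simp_rw [tableMass_eq]
  rw [sum_tableCoef_mul hidx (fun ν => fullProb (p ν))]
  simp [sum_fullProb]

/-- The mean of the number of trials in which the `ν`-th vector yields the outcome `0`. -/
theorem sum_tableMass_mul_expo (hidx : ∀ t, StrictMono (idx t)) (p : Param m) (ν : Fin N) :
    ∑ w, tableMass idx l p w * expo w ν 0 = trials idx l ν * zeroProb (p ν) := by
  classical
  -- A variable `z` marks outcome `0` of the `ν`-th vector. The generating function is then that of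
  -- a binomial variable, and its derivative at `z = 1` is the mean.
  let F : ℝ → (ν : Fin N) → Fin (m ν + 1) → ℝ := fun z =>
    Function.update (fun ν => fullProb (p ν)) ν
      (Function.update (fullProb (p ν)) 0 (zeroProb (p ν) * z))
  have hF : ∀ z (w : Tables m idx l), tableCoef w * ∏ ν, ∏ j, F z ν j ^ expo w ν j
      = tableMass idx l p w * z ^ expo w ν 0 := by
    intro z w
    rw [tableMass_eq, mul_assoc, ← Finset.mul_prod_erase _ _ (Finset.mem_univ ν),
      ← Finset.mul_prod_erase Finset.univ (fun ν => ∏ j, fullProb (p ν) j ^ expo w ν j)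
      (Finset.mem_univ ν), Fin.prod_univ_succ, Fin.prod_univ_succ]
    have : ∀ κ ∈ Finset.univ.erase ν, ∏ j, F z κ j ^ expo w κ j
        = ∏ j, fullProb (p κ) j ^ expo w κ j := by
      intro κ hκ
      simp [F, Function.update_of_ne (Finset.ne_of_mem_erase hκ)]
    rw [Finset.prod_congr rfl this]
    simp only [F, fullProb, mul_pow, Function.update_self, Fin.cons_zero, ne_eq,
      Fin.succ_ne_zero, not_false_eq_true, Function.update_of_ne]
    ring
  have hS : ∀ z, ∑ w : Tables m idx l, tableMass idx l p w * z ^ expo w ν 0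
      = (1 + zeroProb (p ν) * (z - 1)) ^ trials idx l ν := by
    intro z
    simp_rw [← hF]
    rw [sum_tableCoef_mul hidx, Finset.prod_eq_single ν]
    · congr 1
      have := sum_fullProb (p ν)
      rw [Fin.sum_univ_succ] at this ⊢
      simp [F, fullProb] at this ⊢
      linarith
    · intro κ _ hκ
      simp [F, Function.update_of_ne hκ, sum_fullProb]
    · simp
  have h1 : HasDerivAt (fun z => ∑ w : Tables m idx l, tableMass idx l p w * z ^ expo w ν 0)
      (∑ w : Tables m idx l, tableMass idx l p w * expo w ν 0) 1 := by
    have := HasDerivAt.fun_sum (u := Finset.univ) fun (w : Tables m idx l) _ =>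
      (hasDerivAt_pow (expo w ν 0) (1 : ℝ)).const_mul (tableMass idx l p w)
    simpa using this
  have h2 : HasDerivAt (fun z => (1 + zeroProb (p ν) * (z - 1)) ^ trials idx l ν)
      (trials idx l ν * zeroProb (p ν)) 1 := by
    have := ((((hasDerivAt_id (1 : ℝ)).sub_const 1).const_mul (zeroProb (p ν))).const_add
      1).fun_pow (trials idx l ν)
    simpa using this
  rw [funext hS] at h1
  exact h1.unique h2

end Tables

/-! ### Total mass of the negative multinomial distribution -/

theorem hasSum_of_tsum_ofReal {ι : Type*} {f : ι → ℝ} (hf : ∀ i, 0 ≤ f i) {c : ℝ} (hc : 0 ≤ c)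
    (h : ∑' i, ENNReal.ofReal (f i) = ENNReal.ofReal c) : HasSum f c := by
  have h1 := ENNReal.hasSum_toReal (h.trans_ne ENNReal.ofReal_ne_top)
  rw [← ENNReal.tsum_toReal_eq fun _ => ENNReal.ofReal_ne_top, h, ENNReal.toReal_ofReal hc] at h1
  simpa [ENNReal.toReal_ofReal (hf _)] using h1

theorem lintegral_rpow_mul_exp {r c : ℝ} (hr : 0 < r) (hc : 0 < c) :
    ∫⁻ t in Set.Ioi (0 : ℝ), ENNReal.ofReal (t ^ (r - 1) * Real.exp (-(c * t)))
      = ENNReal.ofReal ((1 / c) ^ r * Real.Gamma r) := by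
  have h := Real.integral_rpow_mul_exp_neg_mul_Ioi hr hc
  have hG := Real.Gamma_pos_of_pos hr
  rw [← h, ofReal_integral_eq_lintegral_ofReal]
  · by_contra hi
    rw [integral_undef hi] at h
    have : 0 < (1 / c) ^ r * Real.Gamma r := by positivity
    linarith
  · filter_upwards [ae_restrict_mem measurableSet_Ioi] with t ht
    have : 0 < t := ht
    positivity

theorem tsum_pow_div_factorial {y : ℝ} (hy : 0 ≤ y) :
    ∑' n : ℕ, ENNReal.ofReal (y ^ n / (n ! : ℝ)) = ENNReal.ofReal (Real.exp y) := by
  rw [Real.exp_eq_exp_ℝ, NormedSpace.exp_eq_tsum_div, ENNReal.ofReal_tsum_of_nonneg]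
  · intro n
    positivity
  · exact Real.summable_pow_div_factorial y

theorem negMultinMass_pos {k : ℕ} {r : ℝ} (hr : 0 < r) {q : Fin k → ℝ} (hq : ∀ i, 0 < q i)
    (hq1 : ∑ i, q i < 1) (x : Fin k → ℕ) : 0 < negMultinMass r q x := by
  have h0 : 0 < zeroProb q := sub_pos.2 hq1
  have h1 := Real.Gamma_pos_of_pos hr
  have h2 := Real.Gamma_pos_of_pos (show 0 < r + ∑ i, (x i : ℝ) by positivity)
  have h3 : 0 < ∏ i, ((x i)! : ℝ) := Finset.prod_pos fun i _ => by positivity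
  have h4 : 0 < ∏ i, q i ^ x i := Finset.prod_pos fun i _ => pow_pos (hq i) _
  unfold negMultinMass
  positivity

/-- The negative multinomial mass function has total mass `1`. -/
theorem tsum_negMultinMass {k : ℕ} {r : ℝ} (hr : 0 < r) {q : Fin k → ℝ} (hq : ∀ i, 0 < q i)
    (hq1 : ∑ i, q i < 1) : ∑' x : Fin k → ℕ, ENNReal.ofReal (negMultinMass r q x) = 1 := by
  have h0 : 0 < zeroProb q := sub_pos.2 hq1
  have hG := Real.Gamma_pos_of_pos hr
  -- Gamma mixture of Poisson counts: given `t`, the counts have means `t * q i`. Summation over `x`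
  -- under the integral turns `exp (-t)` into `exp (-(zeroProb q * t))`, and a Gamma integral is
  -- left.
  have h1 : ∀ x : Fin k → ℕ, ENNReal.ofReal (negMultinMass r q x)
      = ENNReal.ofReal (zeroProb q ^ r / Real.Gamma r) * ∫⁻ t in Set.Ioi (0 : ℝ),
        ENNReal.ofReal (t ^ (r - 1) * Real.exp (-(1 * t)))
          * ∏ i, ENNReal.ofReal ((t * q i) ^ x i / ((x i)! : ℝ)) := by
    intro x
    have h3 : 0 < ∏ i, ((x i)! : ℝ) := Finset.prod_pos fun i _ => by positivity
    have h4 : 0 < ∏ i, q i ^ x i := Finset.prod_pos fun i _ => pow_pos (hq i) _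
    have h2 : ∀ t ∈ Set.Ioi (0 : ℝ), ENNReal.ofReal (t ^ (r - 1) * Real.exp (-(1 * t)))
          * ∏ i, ENNReal.ofReal ((t * q i) ^ x i / ((x i)! : ℝ))
        = ENNReal.ofReal ((∏ i, q i ^ x i) / ∏ i, ((x i)! : ℝ))
          * ENNReal.ofReal (t ^ (r + ∑ i, (x i : ℝ) - 1) * Real.exp (-(1 * t))) := by
      intro t ht
      have ht : 0 < t := ht
      rw [← ENNReal.ofReal_prod_of_nonneg fun i _ => by have := hq i; positivity,
        ← ENNReal.ofReal_mul (by positivity), ← ENNReal.ofReal_mul (by positivity)]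
      congr 1
      rw [Finset.prod_div_distrib]
      simp_rw [mul_pow]
      rw [Finset.prod_mul_distrib, Finset.prod_pow_eq_pow_sum,
        show r + ∑ i, (x i : ℝ) - 1 = (r - 1) + ((∑ i, x i : ℕ) : ℝ) by push_cast; ring,
        Real.rpow_add ht, Real.rpow_natCast]
      ring
    rw [setLIntegral_congr_fun measurableSet_Ioi h2, lintegral_const_mul' _ _ ENNReal.ofReal_ne_top,
      lintegral_rpow_mul_exp (by positivity) one_pos, ← ENNReal.ofReal_mul (by positivity),
      ← ENNReal.ofReal_mul (by positivity), negMultinMass]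
    congr 1
    rw [div_one, Real.one_rpow]
    field_simp
  simp_rw [h1]
  rw [ENNReal.tsum_mul_left, ← lintegral_tsum fun x => by fun_prop]
  have h5 : ∀ t ∈ Set.Ioi (0 : ℝ), ∑' x : Fin k → ℕ,
      ENNReal.ofReal (t ^ (r - 1) * Real.exp (-(1 * t)))
          * ∏ i, ENNReal.ofReal ((t * q i) ^ x i / ((x i)! : ℝ))
      = ENNReal.ofReal (t ^ (r - 1) * Real.exp (-(zeroProb q * t))) := by
    intro t ht
    have ht : 0 < t := ht
    rw [ENNReal.tsum_mul_left,
      tsum_pi_prod (fun i (n : ℕ) => ENNReal.ofReal ((t * q i) ^ n / (n ! : ℝ)))]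
    simp_rw [fun i => tsum_pow_div_factorial (mul_pos ht (hq i)).le]
    rw [← ENNReal.ofReal_prod_of_nonneg fun i _ => (Real.exp_pos _).le, ← Real.exp_sum,
      ← ENNReal.ofReal_mul (by positivity), mul_assoc, ← Real.exp_add, ← Finset.mul_sum, zeroProb]
    congr 3
    ring
  rw [setLIntegral_congr_fun measurableSet_Ioi h5, lintegral_rpow_mul_exp hr h0,
    ← ENNReal.ofReal_mul (by positivity), ← ENNReal.ofReal_one]
  congr 1
  rw [Real.div_rpow one_pos.le h0.le, Real.one_rpow]
  have : 0 < zeroProb q ^ r := by positivity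
  field_simp

section

variable {N : ℕ} {m : Fin N → ℕ} {r : Fin N → ℝ} {p : Param m}

theorem obsMass_pos (hr : ∀ ν, 0 < r ν) (hp : p ∈ paramSpace m) (x : Obs m) :
    0 < obsMass r p x :=
  Finset.prod_pos fun ν _ => negMultinMass_pos (hr ν) (hp ν).1 (hp ν).2 _

theorem hasSum_obsMass (hr : ∀ ν, 0 < r ν) (hp : p ∈ paramSpace m) : HasSum (obsMass r p) 1 := by
  refine hasSum_of_tsum_ofReal (fun x => (obsMass_pos hr hp x).le) one_pos.le ?_
  have : ∀ x : Obs m, ENNReal.ofReal (obsMass r p x)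
      = ∏ ν, ENNReal.ofReal (negMultinMass (r ν) (p ν) (x ν)) := fun x =>
    ENNReal.ofReal_prod_of_nonneg fun ν _ => (negMultinMass_pos (hr ν) (hp ν).1 (hp ν).2 _).le
  simp_rw [this]
  rw [tsum_pi_prod (fun ν y => ENNReal.ofReal (negMultinMass (r ν) (p ν) y))]
  simp [fun ν => tsum_negMultinMass (hr ν) (hp ν).1 (hp ν).2]

/-! ### Unit increments of the counts, the Stein-type identity and moments -/

/-- The observation with one more count in cell `i` of the `ν`-th vector. -/
def bump (ν : Fin N) (i : Fin (m ν)) (x : Obs m) : Obs m :=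
  Function.update x ν (Function.update (x ν) i (x ν i + 1))

theorem bump_self (ν : Fin N) (i : Fin (m ν)) (x : Obs m) : bump ν i x ν i = x ν i + 1 := by
  simp [bump]

theorem bump_injective (ν : Fin N) (i : Fin (m ν)) : Function.Injective (bump (m := m) ν i) := by
  intro x y h
  funext κ j
  have h1 := congrFun (congrFun h κ) j
  by_cases hκ : κ = ν
  · subst hκ
    by_cases hj : j = i
    · subst hj
      simpa [bump] using h1
    · simpa [bump, hj] using h1
  · simpa [bump, hκ] using h1

theorem mem_range_bump {ν : Fin N} {i : Fin (m ν)} {y : Obs m} (hy : y ν i ≠ 0) :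
    y ∈ Set.range (bump (m := m) ν i) := by
  refine ⟨Function.update y ν (Function.update (y ν) i (y ν i - 1)), ?_⟩
  simp [bump, Nat.sub_add_cancel (Nat.one_le_iff_ne_zero.2 hy)]

/-- The total count of the `ν`-th vector. -/
def total (x : Obs m) (ν : Fin N) : ℝ := ∑ i, (x ν i : ℝ)

theorem total_nonneg (x : Obs m) (ν : Fin N) : 0 ≤ total x ν :=
  Finset.sum_nonneg fun _ _ => Nat.cast_nonneg _

theorem total_bump_self (ν : Fin N) (i : Fin (m ν)) (x : Obs m) :
    total (bump ν i x) ν = total x ν + 1 := by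
  rw [total, total, ← Finset.add_sum_erase _ _ (Finset.mem_univ i), bump_self,
    ← Finset.add_sum_erase _ (fun i => (x ν i : ℝ)) (Finset.mem_univ i)]
  have : ∀ j ∈ Finset.univ.erase i, (bump ν i x ν j : ℝ) = x ν j := by
    intro j hj
    simp [bump, Finset.ne_of_mem_erase hj]
  rw [Finset.sum_congr rfl this]
  push_cast
  ring

/-- The recursion `Γ(y + 1) = y Γ(y)` read on the mass function. The Stein-type identity and the
moments of the counts both come from it. -/
theorem obsMass_bump (hr : ∀ ν, 0 < r ν) (ν : Fin N) (i : Fin (m ν)) (x : Obs m) :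
    obsMass r p (bump ν i x) * (x ν i + 1) = (r ν + total x ν) * p ν i * obsMass r p x := by
  rw [obsMass, obsMass, ← Finset.mul_prod_erase _ _ (Finset.mem_univ ν),
    ← Finset.mul_prod_erase _ (fun ν => negMultinMass (r ν) (p ν) (x ν)) (Finset.mem_univ ν)]
  have : ∀ κ ∈ Finset.univ.erase ν, negMultinMass (r κ) (p κ) (bump ν i x κ)
      = negMultinMass (r κ) (p κ) (x κ) := by
    intro κ hκ
    simp [bump, Finset.ne_of_mem_erase hκ]
  rw [Finset.prod_congr rfl this]
  suffices negMultinMass (r ν) (p ν) (bump ν i x ν) * (x ν i + 1)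
      = (r ν + total x ν) * p ν i * negMultinMass (r ν) (p ν) (x ν) by
    rw [mul_right_comm, this]
    ring
  have hT : ∑ j, (bump ν i x ν j : ℝ) = total x ν + 1 := total_bump_self ν i x
  have hpos := total_nonneg x ν
  rw [negMultinMass, negMultinMass, hT, ← add_assoc,
    Real.Gamma_add_one (by have := hr ν; positivity), ← Finset.mul_prod_erase _ _ (Finset.mem_univ i),
    ← Finset.mul_prod_erase _ (fun j => p ν j ^ bump ν i x ν j) (Finset.mem_univ i),
    ← Finset.mul_prod_erase _ (fun j => ((x ν j)! : ℝ)) (Finset.mem_univ i),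
    ← Finset.mul_prod_erase _ (fun j => p ν j ^ x ν j) (Finset.mem_univ i)]
  have h1 : ∀ j ∈ Finset.univ.erase i, bump ν i x ν j = x ν j := by
    intro j hj
    simp [bump, Finset.ne_of_mem_erase hj]
  have h5 : ∏ j ∈ Finset.univ.erase i, ((bump ν i x ν j)! : ℝ)
      = ∏ j ∈ Finset.univ.erase i, ((x ν j)! : ℝ) :=
    Finset.prod_congr rfl fun j hj => by rw [h1 j hj]
  have h6 : ∏ j ∈ Finset.univ.erase i, p ν j ^ bump ν i x ν j
      = ∏ j ∈ Finset.univ.erase i, p ν j ^ x ν j :=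
    Finset.prod_congr rfl fun j hj => by rw [h1 j hj]
  rw [h5, h6, bump_self, Nat.factorial_succ,
    pow_succ]
  have h2 : (∏ j ∈ Finset.univ.erase i, ((x ν j)! : ℝ)) ≠ 0 :=
    Finset.prod_ne_zero_iff.2 fun j _ => by positivity
  have h3 := (Real.Gamma_pos_of_pos (hr ν)).ne'
  have h4 : ((x ν i)! : ℝ) ≠ 0 := by positivity
  push_cast
  change _ = _ * (Real.Gamma (r ν + total x ν) / _ * _ * _)
  field_simp

theorem obsMass_update (hr : ∀ ν, 0 < r ν) (hp : p ∈ paramSpace m) (ν : Fin N) (x : Obs m) :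
    obsMass (Function.update r ν (r ν + 1)) p x * r ν
      = (r ν + total x ν) * zeroProb (p ν) * obsMass r p x := by
  rw [obsMass, obsMass, ← Finset.mul_prod_erase _ _ (Finset.mem_univ ν),
    ← Finset.mul_prod_erase _ (fun ν => negMultinMass (r ν) (p ν) (x ν)) (Finset.mem_univ ν)]
  have : ∀ κ ∈ Finset.univ.erase ν,
      negMultinMass (Function.update r ν (r ν + 1) κ) (p κ) (x κ)
      = negMultinMass (r κ) (p κ) (x κ) := by
    intro κ hκ
    simp [Finset.ne_of_mem_erase hκ]
  rw [Finset.prod_congr rfl this, Function.update_self]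
  have hpos := total_nonneg x ν
  have hν := hr ν
  have hG := Real.Gamma_pos_of_pos hν
  rw [negMultinMass, negMultinMass, Real.Gamma_add_one hν.ne', add_right_comm,
    Real.Gamma_add_one (by change r ν + total x ν ≠ 0; positivity),
    Real.rpow_add_one (zeroProb_pos hp ν).ne']
  have h2 : (∏ j, ((x ν j)! : ℝ)) ≠ 0 := Finset.prod_ne_zero_iff.2 fun j _ => by positivity
  change _ = (_ + ∑ i, (x ν i : ℝ)) * _ * _
  field_simp

/-- The shift `x ↦ x + eᵢ` misses only the observations with `x ν i = 0`, and there the weight `x ν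
i` vanishes. -/
theorem hasSum_bump_iff (ν : Fin N) (i : Fin (m ν)) (g : Obs m → ℝ) (S : ℝ) :
    HasSum (fun x => (x ν i + 1) * g (bump ν i x)) S ↔ HasSum (fun x => x ν i * g x) S := by
  rw [← (bump_injective ν i).hasSum_iff (f := fun x => x ν i * g x)]
  · refine iff_of_eq (congrArg (fun f => HasSum f S) ?_)
    funext x
    simp [bump_self]
  · intro y hy
    by_cases h : y ν i = 0
    · simp [h]
    · exact absurd (mem_range_bump h) hy

/-- The Stein-type identity for negative multinomial observations. -/
theorem hasSum_mul_bump_iff (hr : ∀ ν, 0 < r ν) (ν : Fin N) (i : Fin (m ν)) (ψ : Obs m → ℝ)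
    (S : ℝ) :
    HasSum (fun x => obsMass r p x * (p ν i * ψ (bump ν i x))) S ↔
      HasSum (fun x => obsMass r p x * (x ν i / (r ν + total x ν - 1) * ψ x)) S := by
  -- Expressed at the shifted observation, the factor `r ν + total x ν` of the recursion becomes `r
  -- ν + total - 1`. This is the denominator in the identity.
  have h1 : ∀ x : Obs m, obsMass r p x * (p ν i * ψ (bump ν i x)) = (x ν i + 1)
      * (obsMass r p (bump ν i x) / (r ν + total (bump ν i x) ν - 1) * ψ (bump ν i x)) := by
    intro x
    have h := obsMass_bump (p := p) hr ν i x
    have h0 : r ν + total x ν ≠ 0 := by have := hr ν; have := total_nonneg x ν; positivity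
    rw [total_bump_self, ← add_assoc, add_sub_cancel_right,
      show obsMass r p x * (p ν i * ψ (bump ν i x))
        = (r ν + total x ν) * p ν i * obsMass r p x * ψ (bump ν i x) / (r ν + total x ν) by
        field_simp, ← h]
    ring
  simp_rw [h1]
  rw [hasSum_bump_iff ν i (fun x => obsMass r p x / (r ν + total x ν - 1) * ψ x)]
  refine iff_of_eq (congrArg (fun f => HasSum f S) ?_)
  funext x
  ring

/-- A size-biasing rule: weighting by a count shifts that count by one and raises `r ν` by one.
Applied once and twice, it gives the first and second moments. -/
theorem hasSum_mul_count (hr : ∀ ν, 0 < r ν) (hp : p ∈ paramSpace m) (ν : Fin N) (i : Fin (m ν))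
    {g : Obs m → ℝ} {S : ℝ}
    (h : HasSum (fun x => obsMass (Function.update r ν (r ν + 1)) p x * g (bump ν i x)) S) :
    HasSum (fun x => obsMass r p x * (x ν i * g x)) (r ν * p ν i / zeroProb (p ν) * S) := by
  have h1 := (hasSum_bump_iff ν i (fun x => obsMass r p x * g x)
    (r ν * p ν i / zeroProb (p ν) * S)).1
  simp_rw [mul_left_comm (obsMass r p _)]
  refine h1 ?_
  have h2 := h.mul_left (r ν * p ν i / zeroProb (p ν))
  have h3 : ∀ x : Obs m, r ν * p ν i / zeroProb (p ν)
      * (obsMass (Function.update r ν (r ν + 1)) p x * g (bump ν i x))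
      = (x ν i + 1) * (obsMass r p (bump ν i x) * g (bump ν i x)) := by
    intro x
    have h4 := obsMass_bump (p := p) hr ν i x
    have h5 := obsMass_update hr hp ν x
    have h6 := (zeroProb_pos hp ν).ne'
    rw [← mul_assoc (_ + 1 : ℝ), mul_comm (_ + 1 : ℝ), h4, ← mul_assoc]
    congr 1
    field_simp
    linear_combination p ν i * h5
  simpa only [h3] using h2

/-- The mean of an observed count. -/
theorem hasSum_count (hr : ∀ ν, 0 < r ν) (hp : p ∈ paramSpace m) (ν : Fin N) (i : Fin (m ν)) :
    HasSum (fun x => obsMass r p x * x ν i) (r ν * p ν i / zeroProb (p ν)) := by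
  have hr' : ∀ κ, 0 < Function.update r ν (r ν + 1) κ := by
    intro κ
    by_cases h : κ = ν
    · subst h
      have := hr κ
      simp only [Function.update_self]
      positivity
    · simpa [h] using hr κ
  simpa using hasSum_mul_count hr hp ν i (g := fun _ => 1) (S := 1)
    (by simpa using hasSum_obsMass hr' hp)

/-- The mixed second moment of two observed counts. -/
theorem hasSum_count_mul_count (hr : ∀ ν, 0 < r ν) (hp : p ∈ paramSpace m)
    (j k : (ν : Fin N) × Fin (m ν)) :
    HasSum (fun x => obsMass r p x * (x j.1 j.2 * x k.1 k.2))
      (r j.1 * p j.1 j.2 / zeroProb (p j.1) * (Function.update r j.1 (r j.1 + 1) k.1 * p k.1 k.2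
        / zeroProb (p k.1) + if j = k then 1 else 0)) := by
  obtain ⟨ν, i⟩ := j
  obtain ⟨κ, i'⟩ := k
  have hr' : ∀ κ, 0 < Function.update r ν (r ν + 1) κ := by
    intro κ
    by_cases h : κ = ν
    · subst h
      have := hr κ
      simp only [Function.update_self]
      positivity
    · simpa [h] using hr κ
  refine hasSum_mul_count hr hp ν i (g := fun x => (x κ i' : ℝ)) ?_
  have h1 := (hasSum_count hr' hp κ i').add
    ((hasSum_obsMass hr' hp).mul_right (if (⟨ν, i⟩ : (ν : Fin N) × Fin (m ν)) = ⟨κ, i'⟩ then 1 else 0))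
  rw [one_mul] at h1
  refine (congrArg (fun f => HasSum f _) (funext fun x => ?_)).mp h1
  have : ((bump ν i x κ i' : ℕ) : ℝ)
      = x κ i' + if (⟨ν, i⟩ : (ν : Fin N) × Fin (m ν)) = ⟨κ, i'⟩ then 1 else 0 := by
    by_cases h : κ = ν
    · subst h
      by_cases h' : i' = i
      · subst h'
        simp [bump]
      · simp [bump, h', Ne.symm h']
    · simp [bump, h, Ne.symm h]
  rw [this, mul_add]

end

/-! ### Fisher information and the Jeffreys prior -/

section

variable {N : ℕ} {m : Fin N → ℕ} {r : Fin N → ℝ} {p : Param m}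

/-- Isolates the dependence on one coordinate, which also enters through the zero probability, so
that the score is a one-variable logarithmic derivative. -/
theorem exists_obsMass_update_eq (r : Fin N → ℝ) (p : Param m) (x : Obs m) (ν : Fin N)
    (i : Fin (m ν)) : ∃ K : ℝ, ∀ s,
      obsMass r (Function.update p ν (Function.update (p ν) i s)) x
        = K * ((zeroProb (p ν) + p ν i - s) ^ r ν * s ^ x ν i) := by
  refine ⟨(∏ κ ∈ Finset.univ.erase ν, negMultinMass (r κ) (p κ) (x κ))
    * (Real.Gamma (r ν + ∑ i, (x ν i : ℝ)) / (Real.Gamma (r ν) * ∏ i, ((x ν i)! : ℝ)))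
    * ∏ i' ∈ Finset.univ.erase i, p ν i' ^ x ν i', fun s => ?_⟩
  rw [obsMass, ← Finset.mul_prod_erase _ _ (Finset.mem_univ ν)]
  have h1 : ∀ κ ∈ Finset.univ.erase ν, negMultinMass (r κ)
      (Function.update p ν (Function.update (p ν) i s) κ) (x κ)
      = negMultinMass (r κ) (p κ) (x κ) := by
    intro κ hκ
    rw [Function.update_of_ne (Finset.ne_of_mem_erase hκ)]
  have h2 : ∀ i' ∈ Finset.univ.erase i, Function.update (p ν) i s i' ^ x ν i' = p ν i' ^ x ν i' := by
    intro i' hi'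
    rw [Function.update_of_ne (Finset.ne_of_mem_erase hi')]
  have h3 : zeroProb (Function.update (p ν) i s) = zeroProb (p ν) + p ν i - s := by
    rw [zeroProb, zeroProb, ← Finset.add_sum_erase _ _ (Finset.mem_univ i),
      ← Finset.add_sum_erase _ (p ν) (Finset.mem_univ i), Function.update_self,
      Finset.sum_congr rfl fun i' hi' => Function.update_of_ne (Finset.ne_of_mem_erase hi') s (p ν)]
    ring
  rw [Finset.prod_congr rfl h1, Function.update_self, negMultinMass, h3,
    ← Finset.mul_prod_erase _ (fun i' => Function.update (p ν) i s i' ^ x ν i')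
      (Finset.mem_univ i), Finset.prod_congr rfl h2, Function.update_self]
  ring

theorem score_eq (hr : ∀ ν, 0 < r ν) (hp : p ∈ paramSpace m) (x : Obs m)
    (j : (ν : Fin N) × Fin (m ν)) :
    score r p x j = x j.1 j.2 / p j.1 j.2 - r j.1 / zeroProb (p j.1) := by
  obtain ⟨ν, i⟩ := j
  obtain ⟨K, hK⟩ := exists_obsMass_update_eq r p x ν i
  have h0 := zeroProb_pos hp ν
  have hi := (hp ν).1 i
  have hK0 : K ≠ 0 := by
    rintro rfl
    have h1 := hK (p ν i)
    rw [Function.update_eq_self, Function.update_eq_self, zero_mul] at h1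
    exact (obsMass_pos hr hp x).ne' h1
  rw [score]
  simp only [hK]
  have he : (fun s : ℝ => Real.log (K * ((zeroProb (p ν) + p ν i - s) ^ r ν * s ^ x ν i)))
      =ᶠ[nhds (p ν i)] fun s => Real.log K + (r ν * Real.log (zeroProb (p ν) + p ν i - s)
        + x ν i * Real.log s) := by
    filter_upwards [Ioo_mem_nhds hi (show p ν i < zeroProb (p ν) + p ν i by linarith)] with s hs
    have hs0 : 0 < s := hs.1
    have hs1 : 0 < zeroProb (p ν) + p ν i - s := sub_pos.2 hs.2
    rw [Real.log_mul hK0 (by positivity), Real.log_mul (by positivity) (by positivity),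
      Real.log_rpow hs1, Real.log_pow]
  rw [he.deriv_eq]
  have h1 : zeroProb (p ν) + p ν i - p ν i = zeroProb (p ν) := by ring
  have hd := ((((hasDerivAt_id (p ν i)).const_sub (zeroProb (p ν) + p ν i)).log
    (by simpa using h0.ne')).const_mul (r ν)).add
    ((Real.hasDerivAt_log hi.ne').const_mul (x ν i : ℝ))
  refine (hd.const_add (Real.log K)).deriv.trans ?_
  simp only [id, h1]
  ring

/-- The matrix with the odds `p_{i,ν} / p_{0,ν}` in column `ν`. -/
noncomputable def oddsMatrix (p : Param m) : Matrix ((ν : Fin N) × Fin (m ν)) (Fin N) ℝ :=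
  Matrix.of fun j κ => if j.1 = κ then p j.1 j.2 / zeroProb (p j.1) else 0

/-- The incidence matrix of the cells and the vectors they belong to. -/
def cellMatrix (m : Fin N → ℕ) : Matrix (Fin N) ((ν : Fin N) × Fin (m ν)) ℝ :=
  Matrix.of fun κ j => if j.1 = κ then 1 else 0

/-- Within a block the covariance of the score is diagonal plus a rank-one matrix, and distinct
blocks are uncorrelated. Factoring out the diagonal leaves a perturbation of the identity through
`Fin N`, ready for Sylvester's determinant identity. -/
theorem fisherInfo_eq (hr : ∀ ν, 0 < r ν) (hp : p ∈ paramSpace m) :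
    fisherInfo r p =
      Matrix.diagonal (fun j => r j.1 / (zeroProb (p j.1) * p j.1 j.2))
        * (1 + oddsMatrix p * cellMatrix m) := by
  ext j k
  have hj := (hp j.1).1 j.2
  have hk := (hp k.1).1 k.2
  have hj0 := zeroProb_pos hp j.1
  have hk0 := zeroProb_pos hp k.1
  have h1 := hasSum_count_mul_count hr hp j k
  have h2 := hasSum_count hr hp j.1 j.2
  have h3 := hasSum_count hr hp k.1 k.2
  have h4 := hasSum_obsMass hr hp
  have h5 := (((h1.mul_right (1 / (p j.1 j.2 * p k.1 k.2))).sub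
    (h2.mul_right (r k.1 / zeroProb (p k.1) / p j.1 j.2))).sub
    (h3.mul_right (r j.1 / zeroProb (p j.1) / p k.1 k.2))).add
    (h4.mul_right (r j.1 / zeroProb (p j.1) * (r k.1 / zeroProb (p k.1))))
  have h6 : ∀ x : Obs m, obsMass r p x * (score r p x j * score r p x k)
      = obsMass r p x * (x j.1 j.2 * x k.1 k.2) * (1 / (p j.1 j.2 * p k.1 k.2))
        - obsMass r p x * x j.1 j.2 * (r k.1 / zeroProb (p k.1) / p j.1 j.2)
        - obsMass r p x * x k.1 k.2 * (r j.1 / zeroProb (p j.1) / p k.1 k.2)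
        + obsMass r p x * (r j.1 / zeroProb (p j.1) * (r k.1 / zeroProb (p k.1))) := by
    intro x
    rw [score_eq hr hp, score_eq hr hp]
    field_simp
    ring
  rw [fisherInfo, Matrix.of_apply]
  simp_rw [h6]
  rw [h5.tsum_eq]
  rw [Matrix.diagonal_mul, Matrix.add_apply, Matrix.one_apply, Matrix.mul_apply]
  simp only [oddsMatrix, cellMatrix, Matrix.of_apply, mul_ite, mul_one, mul_zero, Finset.sum_ite_eq, Finset.mem_univ,
    if_true]
  obtain ⟨ν, i⟩ := j
  obtain ⟨κ, i'⟩ := k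
  by_cases hν : ν = κ
  · subst hν
    simp only at *
    by_cases hii : i = i'
    · subst hii
      simp
      field_simp
      ring
    · have : ¬ ((⟨ν, i⟩ : (ν : Fin N) × Fin (m ν)) = ⟨ν, i'⟩) := by simpa using hii
      simp [hii]
      field_simp
      ring
  · simp only at *
    have : ¬ ((⟨ν, i⟩ : (ν : Fin N) × Fin (m ν)) = ⟨κ, i'⟩) := fun h => hν (congrArg Sigma.fst h)
    rw [if_neg this, Function.update_of_ne (Ne.symm hν), if_neg hν]
    field_simp
    ring

/-- By `det (1 + U V) = det (1 + V U)` the determinant reduces to one over `Fin N`. There `V U` is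
diagonal, since the odds of one vector add up to `1 / p₀ - 1`. -/
theorem det_fisherInfo (hr : ∀ ν, 0 < r ν) (hp : p ∈ paramSpace m) :
    (fisherInfo r p).det
      = ∏ ν, (r ν ^ m ν * ((zeroProb (p ν) ^ (m ν + 1))⁻¹ * ∏ i, (p ν i)⁻¹)) := by
  have h1 : cellMatrix m * oddsMatrix p = Matrix.diagonal fun ν => (zeroProb (p ν))⁻¹ - 1 := by
    ext ν κ
    rw [Matrix.mul_apply, Fintype.sum_sigma, Finset.sum_eq_single ν]
    · by_cases h : ν = κ
      · subst h
        have h0 := (zeroProb_pos hp ν).ne'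
        simp only [cellMatrix, oddsMatrix, Matrix.of_apply, if_true, one_mul, Matrix.diagonal_apply_eq]
        rw [← Finset.sum_div, show ∑ i, p ν i = 1 - zeroProb (p ν) by rw [zeroProb]; ring]
        field_simp
      · simp [cellMatrix, oddsMatrix, h]
    · intro κ' _ h
      simp [cellMatrix, h]
    · simp
  rw [fisherInfo_eq hr hp, Matrix.det_mul, Matrix.det_one_add_mul_comm, h1, ← Matrix.diagonal_one,
    Matrix.diagonal_add, Matrix.det_diagonal, Matrix.det_diagonal, Fintype.prod_sigma,
    ← Finset.prod_mul_distrib]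
  refine Finset.prod_congr rfl fun ν _ => ?_
  simp_rw [div_eq_mul_inv, mul_inv]
  rw [Finset.prod_mul_distrib, Finset.prod_mul_distrib, Finset.prod_const, Finset.prod_const,
    Finset.card_univ, Fintype.card_fin, pow_succ, mul_inv, inv_pow]
  ring

/-- Up to a constant factor, the Jeffreys prior is a Dirichlet prior. -/
theorem jeffreysPrior_eq (hr : ∀ ν, 0 < r ν) (hp : p ∈ paramSpace m) :
    jeffreysPrior r p = ENNReal.ofReal (Real.sqrt (∏ ν, r ν ^ m ν))
      * dirichletPrior (fun ν => (1 - (m ν : ℝ)) / 2) (fun _ _ => 1 / 2) p := by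
  rw [jeffreysPrior, dirichletPrior, ← ENNReal.ofReal_mul (Real.sqrt_nonneg _), det_fisherInfo hr hp,
    Finset.prod_mul_distrib, Real.sqrt_mul (Finset.prod_nonneg fun ν _ => pow_nonneg (hr ν).le _)]
  congr 2
  have hpos : ∀ ν i, 0 < p ν i := fun ν i => (hp ν).1 i
  have hz := zeroProb_pos hp
  have hnn : 0 ≤ dirichletKernel (fun ν => (1 - (m ν : ℝ)) / 2) (fun _ _ => 1 / 2) p :=
    Finset.prod_nonneg fun ν _ => mul_nonneg (Real.rpow_nonneg (hz ν).le _)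
      (Finset.prod_nonneg fun i _ => Real.rpow_nonneg (hpos ν i).le _)
  rw [← Real.sqrt_mul_self hnn]
  congr 1
  rw [dirichletKernel, ← Finset.prod_mul_distrib]
  refine Finset.prod_congr rfl fun ν _ => ?_
  rw [mul_mul_mul_comm (_ ^ _), ← Finset.prod_mul_distrib, ← Real.rpow_add (hz ν)]
  congr 1
  · rw [← Real.rpow_natCast, ← Real.rpow_neg (hz ν).le]
    congr 1
    push_cast
    ring
  · refine Finset.prod_congr rfl fun i _ => ?_
    rw [← Real.rpow_add (hpos ν i), ← Real.rpow_neg_one]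
    norm_num

end

/-! ### Bayesian predictive masses do not depend on the scale of the prior -/

section

variable {N L : ℕ} {m : Fin N → ℕ} {d : Fin L → ℕ} {idx : (t : Fin L) → Fin (d t) → Fin N}
  {l : Fin L → ℕ} {r : Fin N → ℝ}

theorem measurableSet_paramSpace : MeasurableSet (paramSpace m) := by
  simp only [paramSpace, Set.ofPred_forall, Set.ofPred_and]
  refine MeasurableSet.iInter fun ν => MeasurableSet.inter (MeasurableSet.iInter fun i => ?_) ?_
  · exact measurableSet_lt (by fun_prop) (by fun_prop)
  · exact measurableSet_lt (by fun_prop) (by fun_prop)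

theorem bayesMass_congr_const_mul {π π' : Param m → ℝ≥0∞} {c : ℝ} (hc : 0 < c)
    (h : ∀ p ∈ paramSpace m, π p = ENNReal.ofReal c * π' p) :
    bayesMass r idx l π = bayesMass r idx l π' := by
  funext x w
  have h1 : ∫⁻ p in paramSpace m,
      π p * ENNReal.ofReal (obsMass r p x) * ENNReal.ofReal (tableMass idx l p w)
      = ENNReal.ofReal c * ∫⁻ p in paramSpace m,
        π' p * ENNReal.ofReal (obsMass r p x) * ENNReal.ofReal (tableMass idx l p w) := by
    rw [← lintegral_const_mul' _ _ ENNReal.ofReal_ne_top]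
    refine setLIntegral_congr_fun measurableSet_paramSpace fun p hp => ?_
    simp only [h p hp, mul_assoc]
  have h2 : ∫⁻ p in paramSpace m, π p * ENNReal.ofReal (obsMass r p x)
      = ENNReal.ofReal c * ∫⁻ p in paramSpace m, π' p * ENNReal.ofReal (obsMass r p x) := by
    rw [← lintegral_const_mul' _ _ ENNReal.ofReal_ne_top]
    refine setLIntegral_congr_fun measurableSet_paramSpace fun p hp => ?_
    simp only [h p hp, mul_assoc]
  rw [bayesMass, bayesMass, h1, h2,
    ENNReal.mul_div_mul_left _ _ (by simpa using hc) ENNReal.ofReal_ne_top]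

theorem bayesMass_jeffreysPrior (hr : ∀ ν, 0 < r ν) :
    bayesMass (m := m) r idx l (jeffreysPrior r)
      = bayesMass r idx l (dirichletPrior (fun ν => (1 - (m ν : ℝ)) / 2) (fun _ _ => 1 / 2)) :=
  bayesMass_congr_const_mul
    (Real.sqrt_pos.2 (Finset.prod_pos fun ν _ => pow_pos (hr ν) (m ν)))
    fun _ hp => jeffreysPrior_eq hr hp

end

/-! ### Normalizing constants of the posterior Dirichlet distributions -/

section

variable {N : ℕ} {m : Fin N → ℕ} {r : Fin N → ℝ} {p : Param m}

/-- The normalizing constant of a product of Dirichlet densities. -/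
noncomputable def dirichletNorm (b : (ν : Fin N) → Fin (m ν + 1) → ℝ) : ℝ :=
  ∏ ν, (∏ j, Real.Gamma (b ν j)) / Real.Gamma (∑ j, b ν j)

theorem dirichletNorm_pos {b : (ν : Fin N) → Fin (m ν + 1) → ℝ} (hb : ∀ ν j, 0 < b ν j) :
    0 < dirichletNorm b :=
  Finset.prod_pos fun ν _ => div_pos (Finset.prod_pos fun j _ => Real.Gamma_pos_of_pos (hb ν j))
    (Real.Gamma_pos_of_pos (Finset.sum_pos (fun j _ => hb ν j) Finset.univ_nonempty))

theorem lintegral_dirichlet {b : (ν : Fin N) → Fin (m ν + 1) → ℝ} (hb : ∀ ν j, 0 < b ν j) :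
    ∫⁻ p in paramSpace m, ENNReal.ofReal (∏ ν, ∏ j, fullProb (p ν) j ^ (b ν j - 1))
      = ENNReal.ofReal (dirichletNorm b) := by
  -- Since `posPow` is zero on the nonpositive half-line, the product over `ν` contains the
  -- indicator of the parameter space, and the integral factorizes over the vectors.
  have h1 : ∀ p : Param m, (paramSpace m).indicator
      (fun p => ENNReal.ofReal (∏ ν, ∏ j, fullProb (p ν) j ^ (b ν j - 1))) p
      = ∏ ν, (posPow (b ν 0) (1 - ∑ i, p ν i) * ∏ i, posPow (b ν (Fin.succ i)) (p ν i)) := by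
    intro p
    by_cases hp : p ∈ paramSpace m
    · rw [Set.indicator_of_mem hp, ENNReal.ofReal_prod_of_nonneg fun ν _ =>
        Finset.prod_nonneg fun j _ => Real.rpow_nonneg (fullProb_pos hp ν j).le _]
      refine Finset.prod_congr rfl fun ν _ => ?_
      rw [ENNReal.ofReal_prod_of_nonneg fun j _ => Real.rpow_nonneg (fullProb_pos hp ν j).le _,
        Fin.prod_univ_succ, posPow_of_pos (sub_pos.2 (hp ν).2)]
      congr 1
      exact Finset.prod_congr rfl fun i _ => (posPow_of_pos ((hp ν).1 i)).symm
    · rw [Set.indicator_of_notMem hp]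
      have : ∃ ν, ¬ ((∀ i, 0 < p ν i) ∧ ∑ i, p ν i < 1) := by
        simpa [paramSpace] using hp
      obtain ⟨ν, hν⟩ := this
      refine (Finset.prod_eq_zero (Finset.mem_univ ν) ?_).symm
      rcases not_and_or.1 hν with h | h
      · obtain ⟨i, hi⟩ := not_forall.1 h
        rw [Finset.prod_eq_zero (Finset.mem_univ i) (posPow_of_nonpos (not_lt.1 hi)), mul_zero]
      · rw [posPow_of_nonpos (t := 1 - _) (by linarith), zero_mul]
  have hm := fun c => measurable_posPow c
  rw [← lintegral_indicator measurableSet_paramSpace]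
  simp_rw [h1]
  rw [lintegral_pi_prod (fun ν (q : Fin (m ν) → ℝ) =>
      posPow (b ν 0) (1 - ∑ i, q i) * ∏ i, posPow (b ν (Fin.succ i)) (q i)) fun ν => by fun_prop,
    dirichletNorm, ENNReal.ofReal_prod_of_nonneg fun ν _ => div_nonneg
      (Finset.prod_nonneg fun j _ => (Real.Gamma_pos_of_pos (hb ν j)).le)
      (Real.Gamma_pos_of_pos (Finset.sum_pos (fun j _ => hb ν j) Finset.univ_nonempty)).le]
  refine Finset.prod_congr rfl fun ν _ => ?_
  rw [lintegral_posPow_simplex (hb ν 0) _ (fun i => hb ν i.succ), posPow_of_pos one_pos,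
    Real.one_rpow, ENNReal.ofReal_one, mul_one, Fin.sum_univ_succ, Fin.prod_univ_succ]

/-- The combinatorial factor of the mass of the observations. -/
noncomputable def obsCoef (r : Fin N → ℝ) (x : Obs m) : ℝ :=
  ∏ ν, (Real.Gamma (r ν + ∑ i, (x ν i : ℝ)) / (Real.Gamma (r ν) * ∏ i, ((x ν i)! : ℝ)))

theorem obsCoef_pos (hr : ∀ ν, 0 < r ν) (x : Obs m) : 0 < obsCoef r x := by
  refine Finset.prod_pos fun ν _ => ?_
  have h1 := hr ν
  have h2 := Real.Gamma_pos_of_pos h1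
  have h3 := Real.Gamma_pos_of_pos (show 0 < r ν + ∑ i, (x ν i : ℝ) by positivity)
  have h4 : 0 < ∏ i, ((x ν i)! : ℝ) := Finset.prod_pos fun i _ => by positivity
  positivity

/-- The parameters of the posterior Dirichlet distributions given `x` and the exponents `c`. -/
noncomputable def postPar (r : Fin N → ℝ) (x : Obs m) (c : (ν : Fin N) → Fin (m ν + 1) → ℕ)
    (u : ℝ) (ν : Fin N) : Fin (m ν + 1) → ℝ :=
  Fin.cons (α := fun _ => ℝ) (u + (1 - (m ν : ℝ)) / 2 + r ν + c ν 0)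
    fun i => 1 / 2 + x ν i + c ν i.succ

theorem postPar_pos (hrm : ∀ ν, ((m ν : ℝ) - 1) / 2 < r ν) (x : Obs m)
    (c : (ν : Fin N) → Fin (m ν + 1) → ℕ) {u : ℝ} (hu : 0 ≤ u) (ν : Fin N) (j : Fin (m ν + 1)) :
    0 < postPar r x c u ν j := by
  refine Fin.cases ?_ (fun i => ?_) j
  · have := hrm ν
    have h : 0 < (1 - (m ν : ℝ)) / 2 + r ν := by linarith
    simp only [postPar, Fin.cons_zero]
    rw [add_assoc u]
    positivity
  · simp only [postPar, Fin.cons_succ]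
    positivity

theorem dirichletKernel_mul_obsMass (hp : p ∈ paramSpace m) (x : Obs m)
    (c : (ν : Fin N) → Fin (m ν + 1) → ℕ) (u : ℝ) :
    dirichletKernel (fun ν => u + (1 - (m ν : ℝ)) / 2) (fun _ _ => 1 / 2) p * obsMass r p x
        * ∏ ν, ∏ j, fullProb (p ν) j ^ c ν j
      = obsCoef r x * ∏ ν, ∏ j, fullProb (p ν) j ^ (postPar r x c u ν j - 1) := by
  rw [dirichletKernel, obsMass, obsCoef, ← Finset.prod_mul_distrib, ← Finset.prod_mul_distrib,
    ← Finset.prod_mul_distrib]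
  refine Finset.prod_congr rfl fun ν _ => ?_
  have h0 := zeroProb_pos hp ν
  have h1 := (hp ν).1
  rw [Fin.prod_univ_succ, Fin.prod_univ_succ, negMultinMass]
  have h2 : zeroProb (p ν) ^ (postPar r x c u ν 0 - 1)
      = zeroProb (p ν) ^ (u + (1 - (m ν : ℝ)) / 2 - 1) * zeroProb (p ν) ^ r ν
        * zeroProb (p ν) ^ c ν 0 := by
    rw [← Real.rpow_natCast, ← Real.rpow_add h0, ← Real.rpow_add h0, postPar, Fin.cons_zero]
    congr 1
    ring
  have h3 : ∀ i, p ν i ^ (postPar r x c u ν i.succ - 1)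
      = p ν i ^ ((1 : ℝ) / 2 - 1) * p ν i ^ x ν i * p ν i ^ c ν i.succ := by
    intro i
    rw [← Real.rpow_natCast, ← Real.rpow_natCast, ← Real.rpow_add (h1 i), ← Real.rpow_add (h1 i),
      postPar, Fin.cons_succ]
    congr 1
    ring
  simp only [fullProb, Fin.cons_zero, Fin.cons_succ, h2, h3, Finset.prod_mul_distrib]
  ring

/-- The marginal mass of `x` and of the exponents `c`, up to factors not depending on `u`. -/
noncomputable def marginal (r : Fin N → ℝ) (x : Obs m) (c : (ν : Fin N) → Fin (m ν + 1) → ℕ)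
    (u : ℝ) : ℝ :=
  dirichletNorm (postPar r x c u)

theorem marginal_pos (hrm : ∀ ν, ((m ν : ℝ) - 1) / 2 < r ν) (x : Obs m)
    (c : (ν : Fin N) → Fin (m ν + 1) → ℕ) {u : ℝ} (hu : 0 ≤ u) : 0 < marginal r x c u :=
  dirichletNorm_pos (postPar_pos hrm x c hu)

/-- Only the exponents of the zero probabilities depend on `u`, and these probabilities are at most
`1`, so the integrand decreases in `u`. -/
theorem marginal_antitone (hrm : ∀ ν, ((m ν : ℝ) - 1) / 2 < r ν) (x : Obs m)
    (c : (ν : Fin N) → Fin (m ν + 1) → ℕ) {u v : ℝ} (hu : 0 ≤ u) (huv : u ≤ v) :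
    marginal r x c v ≤ marginal r x c u := by
  rw [← ENNReal.ofReal_le_ofReal_iff (marginal_pos hrm x c hu).le, marginal, marginal,
    ← lintegral_dirichlet (postPar_pos hrm x c hu),
    ← lintegral_dirichlet (postPar_pos hrm x c (hu.trans huv))]
  refine setLIntegral_mono_ae' measurableSet_paramSpace (ae_of_all _ fun p hp => ?_)
  refine ENNReal.ofReal_le_ofReal (Finset.prod_le_prod (fun ν _ => Finset.prod_nonneg fun j _ =>
    Real.rpow_nonneg (fullProb_pos hp ν j).le _) fun ν _ => ?_)
  refine Finset.prod_le_prod (fun j _ => Real.rpow_nonneg (fullProb_pos hp ν j).le _) fun j _ => ?_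
  refine Fin.cases ?_ (fun i => ?_) j
  · refine Real.rpow_le_rpow_of_exponent_ge (fullProb_pos hp ν 0) ?_ ?_
    · rw [← sum_fullProb (p ν)]
      exact Finset.single_le_sum (fun j _ => (fullProb_pos hp ν j).le) (Finset.mem_univ _)
    · simp only [postPar, Fin.cons_zero]
      linarith
  · simp [postPar]

theorem continuousOn_marginal (hrm : ∀ ν, ((m ν : ℝ) - 1) / 2 < r ν) (x : Obs m)
    (c : (ν : Fin N) → Fin (m ν + 1) → ℕ) : ContinuousOn (marginal r x c) (Set.Ici 0) := by
  have hG : ∀ {y : ℝ}, 0 < y → ContinuousAt Real.Gamma y := fun hy =>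
    (Real.differentiableAt_Gamma fun n =>
      (lt_of_le_of_lt (neg_nonpos.2 n.cast_nonneg) hy).ne').continuousAt
  have hpar : ∀ ν j, Continuous fun u => postPar r x c u ν j := by
    intro ν j
    refine Fin.cases ?_ (fun i => ?_) j
    · simp only [postPar, Fin.cons_zero]
      fun_prop
    · simp only [postPar, Fin.cons_succ]
      fun_prop
  intro u hu
  refine ContinuousAt.continuousWithinAt ?_
  unfold marginal dirichletNorm
  refine tendsto_finsetProd _ fun ν _ => ?_
  have hpos := postPar_pos hrm x c hu ν
  have hS : 0 < ∑ j, postPar r x c u ν j :=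
    Finset.sum_pos (fun j _ => hpos j) Finset.univ_nonempty
  refine ContinuousAt.div ?_ ?_ (Real.Gamma_pos_of_pos hS).ne'
  · exact tendsto_finsetProd _ fun j _ => (hG (hpos j)).comp' (f := fun u => postPar r x c u ν j) (hpar ν j).continuousAt
  · exact (hG hS).comp' (f := fun u => ∑ j, postPar r x c u ν j)
      (continuous_finsetSum _ fun j _ => hpar ν j).continuousAt

theorem measurable_fullProb (ν : Fin N) (j : Fin (m ν + 1)) :
    Measurable fun p : Param m => fullProb (p ν) j := by
  refine Fin.cases ?_ (fun i => ?_) j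
  · simp only [fullProb, zeroProb, Fin.cons_zero]
    fun_prop
  · simp only [fullProb, Fin.cons_succ]
    fun_prop

theorem measurable_obsMass (r : Fin N → ℝ) (x : Obs m) : Measurable fun p => obsMass r p x := by
  unfold obsMass negMultinMass zeroProb
  fun_prop

theorem measurable_dirichletKernel :
    Measurable fun z : Param m × ℝ =>
      dirichletKernel (fun ν => z.2 + (1 - (m ν : ℝ)) / 2) (fun _ _ => 1 / 2) z.1 := by
  unfold dirichletKernel zeroProb
  fun_prop

end

/-! ### Predictive masses under the Dirichlet and shrinkage priors -/

section Tables

variable {N L : ℕ} {m : Fin N → ℕ} {d : Fin L → ℕ} {idx : (t : Fin L) → Fin (d t) → Fin N}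
  {l : Fin L → ℕ} {r : Fin N → ℝ}

theorem measurable_tableMass (w : Tables m idx l) : Measurable fun p => tableMass idx l p w := by
  have := measurable_fullProb (m := m)
  simp_rw [tableMass_eq]
  fun_prop

/-- Covers both integrals of a predictive mass: `c = expo w` with `C = tableCoef w` gives the
numerator, `c = 0` with `C = 1` the denominator. -/
theorem lintegral_kernel_mul (hr : ∀ ν, 0 < r ν) (hrm : ∀ ν, ((m ν : ℝ) - 1) / 2 < r ν) (x : Obs m)
    (c : (ν : Fin N) → Fin (m ν + 1) → ℕ) {C u : ℝ} (hC : 0 < C) (hu : 0 ≤ u) :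
    ∫⁻ p in paramSpace m, ENNReal.ofReal (dirichletKernel (fun ν => u + (1 - (m ν : ℝ)) / 2)
        (fun _ _ => 1 / 2) p * obsMass r p x * (C * ∏ ν, ∏ j, fullProb (p ν) j ^ c ν j))
      = ENNReal.ofReal (obsCoef r x * (C * marginal r x c u)) := by
  have hcoef := obsCoef_pos hr x
  rw [← mul_assoc, ENNReal.ofReal_mul (by positivity), marginal,
    ← lintegral_dirichlet (postPar_pos hrm x c hu), ← lintegral_const_mul' _ _ ENNReal.ofReal_ne_top]
  refine setLIntegral_congr_fun measurableSet_paramSpace fun p hp => ?_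
  rw [← ENNReal.ofReal_mul (by positivity), mul_left_comm, dirichletKernel_mul_obsMass hp]
  congr 1
  ring

theorem dirichletKernel_nonneg {p : Param m} (hp : p ∈ paramSpace m) (a₀ : Fin N → ℝ)
    (a : Param m) : 0 ≤ dirichletKernel a₀ a p :=
  Finset.prod_nonneg fun ν _ => mul_nonneg (Real.rpow_nonneg (zeroProb_pos hp ν).le _)
    (Finset.prod_nonneg fun i _ => Real.rpow_nonneg ((hp ν).1 i).le _)

theorem bayesMass_dirichletPrior (hr : ∀ ν, 0 < r ν) (hrm : ∀ ν, ((m ν : ℝ) - 1) / 2 < r ν)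
    (x : Obs m) (w : Tables m idx l) :
    bayesMass r idx l (dirichletPrior (fun ν => (1 - (m ν : ℝ)) / 2) (fun _ _ => 1 / 2)) x w
      = ENNReal.ofReal (tableCoef w * (marginal r x (expo w) 0 / marginal r x 0 0)) := by
  have hcoef := obsCoef_pos hr x
  have hw := tableCoef_pos w
  have hm := marginal_pos hrm x 0 le_rfl
  have h1 := lintegral_kernel_mul hr hrm x (expo w) hw le_rfl
  have h2 := lintegral_kernel_mul hr hrm x 0 one_pos le_rfl
  simp only [zero_add, Pi.zero_apply, pow_zero, Finset.prod_const_one, mul_one] at h1 h2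
  have h3 : ∀ p ∈ paramSpace m,
      dirichletPrior (fun ν => (1 - (m ν : ℝ)) / 2) (fun _ _ => 1 / 2) p
        * ENNReal.ofReal (obsMass r p x) = ENNReal.ofReal (dirichletKernel
        (fun ν => (1 - (m ν : ℝ)) / 2) (fun _ _ => 1 / 2) p * obsMass r p x) := fun p hp =>
    (ENNReal.ofReal_mul (dirichletKernel_nonneg hp _ _)).symm
  rw [bayesMass, setLIntegral_congr_fun measurableSet_paramSpace h3, h2,
    setLIntegral_congr_fun (g := fun p => ENNReal.ofReal (dirichletKernel
      (fun ν => (1 - (m ν : ℝ)) / 2) (fun _ _ => 1 / 2) p * obsMass r p x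
      * (tableCoef w * ∏ ν, ∏ j, fullProb (p ν) j ^ expo w ν j))) measurableSet_paramSpace
      fun p hp => ?_, h1, ← ENNReal.ofReal_div_of_pos (by positivity)]
  · congr 1
    field_simp
  · beta_reduce
    rw [h3 p hp, ← tableMass_eq, ← ENNReal.ofReal_mul
      (mul_nonneg (dirichletKernel_nonneg hp _ _) (obsMass_pos hr hp x).le)]

/-- The posterior weight of `u`, not normalized. -/
noncomputable def mixWeight (r : Fin N → ℝ) (β : ℝ) (x : Obs m)
    (c : (ν : Fin N) → Fin (m ν + 1) → ℕ) (u : ℝ) : ℝ :=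
  Real.exp (-(β * u)) * marginal r x c u

/-- Tonelli exchanges `u` and `p`, and for each fixed `u` the inner integral is the conjugate one.
The choice `α = 1` removes the power of `u` from the mixing weight. -/
theorem lintegral_shrinkagePrior_mul (hr : ∀ ν, 0 < r ν) (hrm : ∀ ν, ((m ν : ℝ) - 1) / 2 < r ν)
    (x : Obs m) (c : (ν : Fin N) → Fin (m ν + 1) → ℕ) {C : ℝ} (hC : 0 < C) (β : ℝ) :
    ∫⁻ p in paramSpace m,
        shrinkagePrior 1 β (fun _ => 1) (fun ν => (1 - (m ν : ℝ)) / 2) (fun _ _ => 1 / 2) p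
          * ENNReal.ofReal (obsMass r p x * (C * ∏ ν, ∏ j, fullProb (p ν) j ^ c ν j))
      = ∫⁻ u in Set.Ioi (0 : ℝ), ENNReal.ofReal (obsCoef r x * (C * mixWeight r β x c u)) := by
  have hm1 := measurable_obsMass r x
  have hm2 := measurable_fullProb (m := m)
  have hm3 := measurable_dirichletKernel (m := m)
  simp only [shrinkagePrior, one_mul, sub_self, Real.rpow_zero]
  simp_rw [← lintegral_mul_const' _ _ ENNReal.ofReal_ne_top]
  rw [lintegral_lintegral_swap]
  · refine setLIntegral_congr_fun measurableSet_Ioi fun u hu => ?_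
    have hu : 0 ≤ u := le_of_lt hu
    have he := (Real.exp_pos (-(β * u))).le
    rw [mixWeight, show obsCoef r x * (C * (Real.exp (-(β * u)) * marginal r x c u))
      = Real.exp (-(β * u)) * (obsCoef r x * (C * marginal r x c u)) by ring,
      ENNReal.ofReal_mul he, ← lintegral_kernel_mul hr hrm x c hC hu,
      ← lintegral_const_mul' _ _ ENNReal.ofReal_ne_top]
    refine setLIntegral_congr_fun measurableSet_paramSpace fun p hp => ?_
    have hk := dirichletKernel_nonneg hp (fun ν => u + (1 - (m ν : ℝ)) / 2) (fun _ _ => 1 / 2)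
    rw [← ENNReal.ofReal_mul (mul_nonneg he hk), ← ENNReal.ofReal_mul he]
    congr 1
    ring
  · have hm4 : Measurable fun p : Param m =>
        ENNReal.ofReal (obsMass r p x * (C * ∏ ν, ∏ j, fullProb (p ν) j ^ c ν j)) := by fun_prop
    have hm5 : Measurable fun z : Param m × ℝ => ENNReal.ofReal (Real.exp (-(β * z.2))
        * dirichletKernel (fun ν => z.2 + (1 - (m ν : ℝ)) / 2) (fun _ _ => 1 / 2) z.1) := by
      fun_prop
    exact (hm5.mul (hm4.comp measurable_fst)).aemeasurable

/-- Since the marginal mass is largest at `u = 0`, a Gamma density times a constant dominates. -/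
theorem integrableOn_mixWeight_mul (hrm : ∀ ν, ((m ν : ℝ) - 1) / 2 < r ν) (x : Obs m)
    (c : (ν : Fin N) → Fin (m ν + 1) → ℕ) {β : ℝ} (hβ : 0 < β) (n : ℕ) :
    IntegrableOn (fun u => u ^ n * mixWeight r β x c u) (Set.Ioi 0) := by
  have h1 : IntegrableOn (fun u : ℝ => u ^ (n : ℝ) * Real.exp (-β * u)) (Set.Ioi 0) :=
    by
    simpa using integrableOn_rpow_mul_exp_neg_mul_rpow (s := n) (p := 1)
      (by have : (0 : ℝ) ≤ n := n.cast_nonneg; linarith) one_pos hβ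
  refine (h1.mul_const (marginal r x c 0)).mono' ?_ ?_
  · refine ContinuousOn.aestronglyMeasurable ?_ measurableSet_Ioi
    refine ContinuousOn.mul (by fun_prop) (ContinuousOn.mul (by fun_prop) ?_)
    exact (continuousOn_marginal hrm x c).mono Set.Ioi_subset_Ici_self
  · filter_upwards [ae_restrict_mem measurableSet_Ioi] with u hu
    have hu : 0 < u := hu
    have h2 := marginal_pos hrm x c hu.le
    rw [Real.norm_of_nonneg (by unfold mixWeight; positivity), mixWeight, ← mul_assoc,
      Real.rpow_natCast, neg_mul]
    gcongr
    exact marginal_antitone hrm x c le_rfl hu.le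

theorem mixWeight_pos (hrm : ∀ ν, ((m ν : ℝ) - 1) / 2 < r ν) (β : ℝ) (x : Obs m)
    (c : (ν : Fin N) → Fin (m ν + 1) → ℕ) {u : ℝ} (hu : 0 ≤ u) : 0 < mixWeight r β x c u :=
  mul_pos (Real.exp_pos _) (marginal_pos hrm x c hu)

theorem integral_mixWeight_mul_pos (hrm : ∀ ν, ((m ν : ℝ) - 1) / 2 < r ν) (x : Obs m)
    (c : (ν : Fin N) → Fin (m ν + 1) → ℕ) {β : ℝ} (hβ : 0 < β) (n : ℕ) :
    0 < ∫ u in Set.Ioi (0 : ℝ), u ^ n * mixWeight r β x c u := by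
  have hpos : ∀ u ∈ Set.Ioi (0 : ℝ), 0 < u ^ n * mixWeight r β x c u := fun u hu =>
    mul_pos (pow_pos hu n) (mixWeight_pos hrm β x c (le_of_lt hu))
  rw [setIntegral_pos_iff_support_of_nonneg_ae
    (by filter_upwards [ae_restrict_mem measurableSet_Ioi] with u hu using (hpos u hu).le)
    (integrableOn_mixWeight_mul hrm x c hβ n)]
  have : Function.support (fun u => u ^ n * mixWeight r β x c u) ∩ Set.Ioi 0 = Set.Ioi (0 : ℝ) :=
    Set.inter_eq_right.2 fun u hu => (hpos u hu).ne'
  rw [this]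
  simp

theorem bayesMass_shrinkagePrior (hr : ∀ ν, 0 < r ν) (hrm : ∀ ν, ((m ν : ℝ) - 1) / 2 < r ν)
    {β : ℝ} (hβ : 0 < β) (x : Obs m) (w : Tables m idx l) :
    bayesMass r idx l
        (shrinkagePrior 1 β (fun _ => 1) (fun ν => (1 - (m ν : ℝ)) / 2) (fun _ _ => 1 / 2)) x w
      = ENNReal.ofReal (tableCoef w * ((∫ u in Set.Ioi (0 : ℝ), mixWeight r β x (expo w) u)
        / ∫ u in Set.Ioi (0 : ℝ), mixWeight r β x 0 u)) := by
  have hcoef := obsCoef_pos hr x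
  have hw := tableCoef_pos w
  have hpos := integral_mixWeight_mul_pos hrm x 0 hβ 0
  have hint := fun c => integrableOn_mixWeight_mul hrm x c hβ 0
  simp only [pow_zero, one_mul] at hpos hint
  have h1 := lintegral_shrinkagePrior_mul hr hrm x (expo w) hw β
  have h2 := lintegral_shrinkagePrior_mul hr hrm x 0 one_pos β
  have h4 : ∀ (c : (ν : Fin N) → Fin (m ν + 1) → ℕ) {C : ℝ}, 0 < C →
      ∫⁻ u in Set.Ioi (0 : ℝ), ENNReal.ofReal (obsCoef r x * (C * mixWeight r β x c u))
      = ENNReal.ofReal (obsCoef r x * (C * ∫ u in Set.Ioi (0 : ℝ), mixWeight r β x c u)) := by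
    intro c C hC
    rw [← integral_const_mul, ← integral_const_mul, ofReal_integral_eq_lintegral_ofReal]
    · exact ((hint c).const_mul _).const_mul _
    · filter_upwards [ae_restrict_mem measurableSet_Ioi] with u hu
      have := mixWeight_pos hrm β x c (le_of_lt hu)
      positivity
  rw [h4 _ hw] at h1
  rw [h4 _ one_pos] at h2
  simp only [Pi.zero_apply, pow_zero, Finset.prod_const_one, mul_one, one_mul] at h2
  rw [bayesMass, h2, setLIntegral_congr_fun (g := fun p => shrinkagePrior 1 β (fun _ => 1)
      (fun ν => (1 - (m ν : ℝ)) / 2) (fun _ _ => 1 / 2) p * ENNReal.ofReal (obsMass r p x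
      * (tableCoef w * ∏ ν, ∏ j, fullProb (p ν) j ^ expo w ν j))) measurableSet_paramSpace
      fun p hp => ?_, h1, ← ENNReal.ofReal_div_of_pos (by positivity)]
  · congr 1
    field_simp
  · beta_reduce
    rw [← tableMass_eq, ENNReal.ofReal_mul (obsMass_pos hr hp x).le, mul_assoc]

/-- A Bayesian predictive mass with positive finite normalizing constants has total mass `1`. -/
theorem isPredictiveMass_bayesMass (hidx : ∀ t, StrictMono (idx t)) {π : Param m → ℝ≥0∞}
    (hπ : Measurable π)
    (h0 : ∀ x, ∫⁻ p in paramSpace m, π p * ENNReal.ofReal (obsMass r p x) ≠ 0)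
    (h1 : ∀ x, ∫⁻ p in paramSpace m, π p * ENNReal.ofReal (obsMass r p x) ≠ ∞) :
    IsPredictiveMass (bayesMass r idx l π) := by
  intro x
  have hm1 := measurable_obsMass r x
  have hm2 := fun w : Tables m idx l => measurable_tableMass w
  simp_rw [bayesMass, div_eq_mul_inv]
  rw [ENNReal.tsum_mul_right, tsum_fintype, ← lintegral_finsetSum _ fun w _ => by fun_prop]
  rw [setLIntegral_congr_fun (g := fun p => π p * ENNReal.ofReal (obsMass r p x))
    measurableSet_paramSpace fun p hp => ?_, ENNReal.mul_inv_cancel (h0 x) (h1 x)]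
  simp only
  rw [← Finset.mul_sum, ← ENNReal.ofReal_sum_of_nonneg fun w _ => (tableMass_pos hp w).le,
    sum_tableMass hidx, ENNReal.ofReal_one, mul_one]

theorem isPredictiveMass_dirichletPrior (hidx : ∀ t, StrictMono (idx t)) (hr : ∀ ν, 0 < r ν)
    (hrm : ∀ ν, ((m ν : ℝ) - 1) / 2 < r ν) :
    IsPredictiveMass (bayesMass r idx l
      (dirichletPrior (m := m) (fun ν => (1 - (m ν : ℝ)) / 2) (fun _ _ => 1 / 2))) := by
  have h : ∀ x : Obs m, ∫⁻ p in paramSpace m,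
      dirichletPrior (fun ν => (1 - (m ν : ℝ)) / 2) (fun _ _ => 1 / 2) p
        * ENNReal.ofReal (obsMass r p x) = ENNReal.ofReal (obsCoef r x * marginal r x 0 0) := by
    intro x
    have h2 := lintegral_kernel_mul hr hrm x 0 one_pos le_rfl
    simp only [zero_add, Pi.zero_apply, pow_zero, Finset.prod_const_one, mul_one, one_mul] at h2
    rw [← h2]
    exact setLIntegral_congr_fun measurableSet_paramSpace fun p hp =>
      (ENNReal.ofReal_mul (dirichletKernel_nonneg hp _ _)).symm
  refine isPredictiveMass_bayesMass hidx ?_ (fun x => ?_) fun x => ?_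
  · have := (measurable_dirichletKernel (m := m)).comp (measurable_id.prodMk measurable_const)
      (f := fun p : Param m => (p, (0 : ℝ)))
    simp only [Function.comp_def, zero_add] at this
    exact this.ennreal_ofReal
  · rw [h x, ne_eq, ENNReal.ofReal_eq_zero, not_le]
    exact mul_pos (obsCoef_pos hr x) (marginal_pos hrm x 0 le_rfl)
  · rw [h x]
    exact ENNReal.ofReal_ne_top

theorem isPredictiveMass_shrinkagePrior (hidx : ∀ t, StrictMono (idx t)) (hr : ∀ ν, 0 < r ν)
    (hrm : ∀ ν, ((m ν : ℝ) - 1) / 2 < r ν) {β : ℝ} (hβ : 0 < β) :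
    IsPredictiveMass (bayesMass r idx l (shrinkagePrior (m := m) 1 β (fun _ => 1)
      (fun ν => (1 - (m ν : ℝ)) / 2) (fun _ _ => 1 / 2))) := by
  have h : ∀ x : Obs m, ∫⁻ p in paramSpace m, shrinkagePrior 1 β (fun _ => 1)
      (fun ν => (1 - (m ν : ℝ)) / 2) (fun _ _ => 1 / 2) p * ENNReal.ofReal (obsMass r p x)
      = ENNReal.ofReal (obsCoef r x * ∫ u in Set.Ioi (0 : ℝ), mixWeight r β x 0 u) := by
    intro x
    have hint := integrableOn_mixWeight_mul hrm x 0 hβ 0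
    have h2 := lintegral_shrinkagePrior_mul hr hrm x 0 one_pos β
    simp only [Pi.zero_apply, pow_zero, Finset.prod_const_one, mul_one, one_mul] at h2 hint
    rw [h2, ← integral_const_mul, ofReal_integral_eq_lintegral_ofReal (hint.const_mul _)]
    filter_upwards [ae_restrict_mem measurableSet_Ioi] with u hu
    exact (mul_pos (obsCoef_pos hr x) (mixWeight_pos hrm β x 0 (le_of_lt hu))).le
  refine isPredictiveMass_bayesMass hidx ?_ (fun x => ?_) fun x => ?_
  · have hm3 := measurable_dirichletKernel (m := m)
    unfold shrinkagePrior
    simp_rw [one_mul]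
    refine Measurable.lintegral_prod_right' (f := fun z : Param m × ℝ => ENNReal.ofReal
      (z.2 ^ ((1 : ℝ) - 1) * Real.exp (-(β * z.2)) * dirichletKernel
        (fun ν => z.2 + (1 - (m ν : ℝ)) / 2) (fun _ _ => 1 / 2) z.1)) ?_
    fun_prop
  · have hpos := integral_mixWeight_mul_pos hrm x 0 hβ 0
    simp only [pow_zero, one_mul] at hpos
    rw [h x, ne_eq, ENNReal.ofReal_eq_zero, not_le]
    exact mul_pos (obsCoef_pos hr x) hpos
  · rw [h x]
    exact ENNReal.ofReal_ne_top

end Tables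

/-! ### Exponential bounds for rising factorials -/

/-- The rising factorial `y (y + 1) ⋯ (y + n - 1)`. -/
noncomputable def rise (y : ℝ) (n : ℕ) : ℝ := ∏ k ∈ Finset.range n, (y + k)

theorem rise_pos {y : ℝ} (hy : 0 < y) (n : ℕ) : 0 < rise y n :=
  Finset.prod_pos fun k _ => by positivity

theorem Gamma_add_natCast {y : ℝ} (hy : 0 < y) (n : ℕ) :
    Real.Gamma (y + n) = rise y n * Real.Gamma y := by
  induction n with
  | zero => simp [rise]
  | succ n ih =>
    rw [Nat.cast_succ, ← add_assoc, Real.Gamma_add_one (by positivity), ih, rise, rise,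
      Finset.prod_range_succ]
    ring

/-- Factor by factor, `(y + k) / (y + k + u) = 1 - u / (y + k + u) ≤ exp (-u / (y + k + u))`, and `y
+ k ≤ a` makes the exponent uniform in `k`. -/
theorem rise_mul_exp_le {y u a : ℝ} (hy : 0 < y) (hu : 0 ≤ u) (n : ℕ)
    (ha : ∀ k < n, y + k ≤ a) : rise y n * Real.exp (n * (u / (a + u))) ≤ rise (u + y) n := by
  rw [Real.exp_nat_mul, ← Finset.card_range n, ← Finset.prod_const, Finset.card_range, rise, rise,
    ← Finset.prod_mul_distrib]
  refine Finset.prod_le_prod (fun k _ => by positivity) fun k hk => ?_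
  have hk := ha k (Finset.mem_range.1 hk)
  have hyk : 0 < y + k := by positivity
  have h1 : (y + k) / (y + k + u) ≤ Real.exp (-(u / (a + u))) := by
    have h2 := Real.add_one_le_exp (-(u / (a + u)))
    have h3 : u / (a + u) ≤ u / (y + k + u) := by gcongr
    have h4 : (y + k) / (y + k + u) = 1 - u / (y + k + u) := by
      field_simp
      ring
    linarith
  rw [div_le_iff₀ (by positivity), Real.exp_neg, inv_mul_eq_div, le_div_iff₀ (Real.exp_pos _)] at h1
  linarith

/-- Factor by factor, `y + k + u ≤ (y + k) (1 + u / y)`, followed by `1 + u / y ≤ exp (u / y)`. -/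
theorem rise_le_mul_exp {y u : ℝ} (hy : 0 < y) (hu : 0 ≤ u) (n : ℕ) :
    rise (u + y) n ≤ rise y n * Real.exp (n * (u / y)) := by
  rw [Real.exp_nat_mul, ← Finset.card_range n, ← Finset.prod_const, Finset.card_range, rise, rise,
    ← Finset.prod_mul_distrib]
  refine Finset.prod_le_prod (fun k _ => by positivity) fun k hk => ?_
  have hyk : 0 < y + k := by positivity
  have h1 := Real.add_one_le_exp (u / y)
  have h2 : u ≤ (y + k) * (u / y) := by
    rw [← mul_div_assoc, le_div_iff₀ hy, mul_comm]
    have : (0 : ℝ) ≤ k := k.cast_nonneg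
    gcongr
    linarith
  nlinarith

/-! ### Comparison of the marginal masses at `u` and at `0` -/

section

variable {N : ℕ} {m : Fin N → ℕ} {r : Fin N → ℝ} {β : ℝ}

/-- The sum of the posterior parameters of the `ν`-th vector. -/
noncomputable def postSum (r : Fin N → ℝ) (x : Obs m) (ν : Fin N) : ℝ := r ν + total x ν + 1 / 2

theorem sum_postPar (x : Obs m) (u : ℝ) (ν : Fin N) :
    ∑ j, postPar r x 0 u ν j = u + postSum r x ν := by
  rw [Fin.sum_univ_succ]
  simp only [postPar, Fin.cons_zero, Fin.cons_succ, Pi.zero_apply, Nat.cast_zero, add_zero,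
    Finset.sum_add_distrib, Finset.sum_const, Finset.card_univ, Fintype.card_fin, nsmul_eq_mul,
    postSum, total]
  ring

theorem postPar_add (x : Obs m) (c : (ν : Fin N) → Fin (m ν + 1) → ℕ) (u : ℝ) (ν : Fin N)
    (j : Fin (m ν + 1)) : postPar r x c u ν j = postPar r x 0 u ν j + c ν j := by
  refine Fin.cases ?_ (fun i => ?_) j <;> simp [postPar]

/-- Passing from `0` to `c` moves each Gamma argument by a natural number, so the change is a
product of rising factorials. -/
theorem marginal_eq (hrm : ∀ ν, ((m ν : ℝ) - 1) / 2 < r ν) (x : Obs m)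
    (c : (ν : Fin N) → Fin (m ν + 1) → ℕ) {u : ℝ} (hu : 0 ≤ u) :
    marginal r x c u = marginal r x 0 u * ∏ ν, ((∏ j, rise (postPar r x 0 u ν j) (c ν j))
      / rise (u + postSum r x ν) (∑ j, c ν j)) := by
  rw [marginal, marginal, dirichletNorm, dirichletNorm, ← Finset.prod_mul_distrib]
  refine Finset.prod_congr rfl fun ν _ => ?_
  have hpos := postPar_pos hrm x 0 hu ν
  have hS : 0 < ∑ j, postPar r x 0 u ν j :=
    Finset.sum_pos (fun j _ => hpos j) Finset.univ_nonempty
  simp_rw [postPar_add x c u ν, fun j => Gamma_add_natCast (hpos j) (c ν j)]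
  rw [Finset.sum_add_distrib, ← Nat.cast_sum, Gamma_add_natCast hS, Finset.prod_mul_distrib,
    sum_postPar]
  ring

theorem postSum_pos (hr : ∀ ν, 0 < r ν) (x : Obs m) (ν : Fin N) : 0 < postSum r x ν := by
  have := hr ν
  have := total_nonneg x ν
  unfold postSum
  positivity

/-- One more count in cell `i` multiplies the posterior weight of `u` by the posterior mean of `p ν
i` given `u`, which is `(x ν i + 1 / 2) / (postSum r x ν + u)`. The dependence on `i` is a constant
factor, which cancels in posterior means. -/
theorem mixWeight_bump (hr : ∀ ν, 0 < r ν) (hrm : ∀ ν, ((m ν : ℝ) - 1) / 2 < r ν) (x : Obs m)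
    (ν : Fin N) (i : Fin (m ν)) {u : ℝ} (hu : 0 ≤ u) :
    (postSum r x ν + u) * mixWeight r β (bump ν i x) 0 u
      = (x ν i + 1 / 2) * mixWeight r β x 0 u := by
  -- An extra count has the same effect on the Dirichlet parameters as a unit exponent at that cell.
  let c : (ν : Fin N) → Fin (m ν + 1) → ℕ := Function.update 0 ν (Pi.single i.succ 1)
  have h1 : marginal r (bump ν i x) 0 u = marginal r x c u := by
    rw [marginal, marginal]
    congr 1
    funext κ j
    by_cases hκ : κ = ν
    · subst hκ
      refine Fin.cases ?_ (fun i' => ?_) j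
      · simp [postPar, c, Pi.single_apply, (Fin.succ_ne_zero _).symm]
      · by_cases hi : i' = i
        · subst hi
          simp [postPar, c, bump]
          ring
        · simp [postPar, c, bump, hi]
    · refine Fin.cases ?_ (fun i' => ?_) j <;> simp [postPar, c, bump, hκ]
  have h2 : ∏ κ, ((∏ j, rise (postPar r x 0 u κ j) (c κ j))
      / rise (u + postSum r x κ) (∑ j, c κ j)) = (x ν i + 1 / 2) / (u + postSum r x ν) := by
    rw [Finset.prod_eq_single ν]
    · rw [Finset.prod_eq_single i.succ]
      · simp [c, rise, postPar, add_comm]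
      · intro j _ hj
        simp [c, hj, rise]
      · simp
    · intro κ _ hκ
      simp [c, hκ, rise]
    · simp
  have hT := postSum_pos hr x ν
  rw [mixWeight, h1, marginal_eq hrm x c hu, h2, mixWeight]
  field_simp
  ring

/-- The lower bound of the logarithm of the ratio of the two predictive masses, given `u`. -/
noncomputable def gainAt (a : Fin N → ℝ) (n : Fin N → ℕ) (r : Fin N → ℝ) (x : Obs m)
    (c : (ν : Fin N) → Fin (m ν + 1) → ℕ) (u : ℝ) : ℝ :=
  ∑ ν, ((c ν 0 : ℝ) * (u / (a ν + u)) - n ν * (u / postSum r x ν))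

/-- The factors of the nonzero cells do not involve `u` and cancel. The zero cell is bounded by
`rise_mul_exp_le` and the normalizing sum by `rise_le_mul_exp`. -/
theorem marginal_ratio_le (hr : ∀ ν, 0 < r ν) (hrm : ∀ ν, ((m ν : ℝ) - 1) / 2 < r ν) (x : Obs m)
    {c : (ν : Fin N) → Fin (m ν + 1) → ℕ} {n : Fin N → ℕ} (hc : ∀ ν, ∑ j, c ν j = n ν)
    {a : Fin N → ℝ} (ha : ∀ ν, ∀ k < n ν, (1 - (m ν : ℝ)) / 2 + r ν + k ≤ a ν) {u : ℝ} (hu : 0 ≤ u) :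
    marginal r x c 0 / marginal r x 0 0 * Real.exp (gainAt a n r x c u) * marginal r x 0 u
      ≤ marginal r x c u := by
  rw [marginal_eq hrm x c hu, marginal_eq hrm x c le_rfl,
    mul_div_cancel_left₀ _ (marginal_pos hrm x 0 le_rfl).ne', mul_comm (marginal r x 0 u)]
  refine mul_le_mul_of_nonneg_right ?_ (marginal_pos hrm x 0 hu).le
  rw [gainAt, Real.exp_sum, ← Finset.prod_mul_distrib]
  have hpos : ∀ v : ℝ, 0 ≤ v → ∀ ν j, 0 < postPar r x 0 v ν j := fun v hv ν =>
    postPar_pos hrm x 0 hv ν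
  refine Finset.prod_le_prod (fun ν _ => ?_) fun ν _ => ?_
  · exact mul_nonneg (div_nonneg (Finset.prod_nonneg fun j _ => (rise_pos (hpos 0 le_rfl ν j) _).le)
      (rise_pos (by rw [zero_add]; exact postSum_pos hr x ν) _).le) (Real.exp_pos _).le
  have hT := postSum_pos hr x ν
  have hA : 0 < (1 - (m ν : ℝ)) / 2 + r ν := by have := hrm ν; linarith
  rw [Fin.prod_univ_succ, Fin.prod_univ_succ, hc, zero_add]
  have h1 := rise_mul_exp_le hA hu (c ν 0) (a := a ν) fun k hk => ha ν k (lt_of_lt_of_le hk (by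
    rw [← hc ν]
    exact Finset.single_le_sum (fun _ _ => Nat.zero_le _) (Finset.mem_univ _)))
  have h2 := rise_le_mul_exp hT hu (n ν)
  have e1 : ∀ v, postPar r x 0 v ν 0 = v + ((1 - (m ν : ℝ)) / 2 + r ν) := by
    intro v
    simp [postPar, add_assoc]
  have e2 : ∀ i : Fin (m ν), postPar r x 0 u ν i.succ = postPar r x 0 0 ν i.succ := by
    intro i
    simp [postPar]
  simp_rw [e2]
  rw [e1, e1, zero_add, Real.exp_sub]
  have hP : 0 < ∏ i : Fin (m ν), rise (postPar r x 0 0 ν i.succ) (c ν i.succ) :=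
    Finset.prod_pos fun i _ => rise_pos (hpos 0 le_rfl ν _) _
  have hr1 := rise_pos hT (n ν)
  have hr2 : 0 < rise (u + postSum r x ν) (n ν) := rise_pos (by positivity) _
  rw [div_mul_div_comm, div_le_div_iff₀ (mul_pos hr1 (Real.exp_pos _)) hr2]
  calc _ = (rise ((1 - (m ν : ℝ)) / 2 + r ν) (c ν 0) * Real.exp (c ν 0 * (u / (a ν + u))))
        * (∏ i : Fin (m ν), rise (postPar r x 0 0 ν i.succ) (c ν i.succ))
        * rise (u + postSum r x ν) (n ν) := by ring
    _ ≤ _ := by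
      refine mul_le_mul (mul_le_mul_of_nonneg_right h1 hP.le) h2 hr2.le ?_
      exact mul_nonneg (rise_pos (by positivity) _).le hP.le

/-! ### Posterior means of functions of `u` -/

/-- The posterior mean of a function of `u`. -/
noncomputable def postMean (r : Fin N → ℝ) (β : ℝ) (x : Obs m) (g : ℝ → ℝ) : ℝ :=
  (∫ u in Set.Ioi (0 : ℝ), g u * mixWeight r β x 0 u)
    / ∫ u in Set.Ioi (0 : ℝ), mixWeight r β x 0 u

/-- Measurable functions of at most quadratic growth, which have a posterior mean. -/
def QuadBounded (g : ℝ → ℝ) : Prop :=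
  ContinuousOn g (Set.Ioi 0) ∧ ∃ C, ∀ u, 0 < u → |g u| ≤ C * (1 + u ^ 2)

theorem QuadBounded.integrableOn {g : ℝ → ℝ} (hg : QuadBounded g)
    (hrm : ∀ ν, ((m ν : ℝ) - 1) / 2 < r ν) (hβ : 0 < β) (x : Obs m) :
    IntegrableOn (fun u => g u * mixWeight r β x 0 u) (Set.Ioi 0) := by
  obtain ⟨hc, C, hC⟩ := hg
  have h0 := integrableOn_mixWeight_mul hrm x 0 hβ 0
  have h2 := integrableOn_mixWeight_mul hrm x 0 hβ 2
  refine ((h0.add h2).const_mul C).mono' ?_ ?_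
  · refine ContinuousOn.aestronglyMeasurable ?_ measurableSet_Ioi
    refine ContinuousOn.mul hc (ContinuousOn.mul (by fun_prop) ?_)
    exact (continuousOn_marginal hrm x 0).mono Set.Ioi_subset_Ici_self
  · filter_upwards [ae_restrict_mem measurableSet_Ioi] with u hu
    have hw := mixWeight_pos hrm β x 0 (le_of_lt hu)
    rw [norm_mul, Real.norm_of_nonneg hw.le]
    calc _ ≤ C * (1 + u ^ 2) * mixWeight r β x 0 u :=
          mul_le_mul_of_nonneg_right (hC u hu) hw.le
      _ = _ := by simp only [Pi.add_apply]; ring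

theorem integral_mixWeight_pos (hrm : ∀ ν, ((m ν : ℝ) - 1) / 2 < r ν) (hβ : 0 < β) (x : Obs m)
    (c : (ν : Fin N) → Fin (m ν + 1) → ℕ) : 0 < ∫ u in Set.Ioi (0 : ℝ), mixWeight r β x c u := by
  simpa using integral_mixWeight_mul_pos hrm x c hβ 0

theorem postMean_mono {g h : ℝ → ℝ} (hg : QuadBounded g) (hh : QuadBounded h)
    (hgh : ∀ u, 0 < u → g u ≤ h u)
    (hrm : ∀ ν, ((m ν : ℝ) - 1) / 2 < r ν) (hβ : 0 < β) (x : Obs m) :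
    postMean r β x g ≤ postMean r β x h := by
  refine div_le_div_of_nonneg_right ?_ (integral_mixWeight_pos hrm hβ x 0).le
  exact setIntegral_mono_on (hg.integrableOn hrm hβ x) (hh.integrableOn hrm hβ x) measurableSet_Ioi
    fun u hu => mul_le_mul_of_nonneg_right (hgh u hu) (mixWeight_pos hrm β x 0 (le_of_lt hu)).le

theorem postMean_add {g h : ℝ → ℝ} (hg : QuadBounded g) (hh : QuadBounded h)
    (hrm : ∀ ν, ((m ν : ℝ) - 1) / 2 < r ν) (hβ : 0 < β) (x : Obs m) :
    postMean r β x (fun u => g u + h u) = postMean r β x g + postMean r β x h := by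
  simp_rw [postMean, add_mul]
  rw [integral_add (hg.integrableOn hrm hβ x) (hh.integrableOn hrm hβ x), add_div]

theorem postMean_const_mul (C : ℝ) (g : ℝ → ℝ) (x : Obs m) :
    postMean r β x (fun u => C * g u) = C * postMean r β x g := by
  simp_rw [postMean, mul_assoc]
  rw [integral_const_mul, mul_div_assoc]

theorem postMean_const (hrm : ∀ ν, ((m ν : ℝ) - 1) / 2 < r ν) (hβ : 0 < β) (C : ℝ) (x : Obs m) :
    postMean r β x (fun _ => C) = C := by
  rw [postMean, integral_const_mul, mul_div_cancel_right₀ _ (integral_mixWeight_pos hrm hβ x 0).ne']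

theorem QuadBounded.const_mul {g : ℝ → ℝ} (hg : QuadBounded g) (C : ℝ) :
    QuadBounded fun u => C * g u := by
  obtain ⟨hc, D, hD⟩ := hg
  refine ⟨continuousOn_const.mul hc, |C| * D, fun u hu => ?_⟩
  rw [abs_mul, mul_assoc]
  exact mul_le_mul_of_nonneg_left (hD u hu) (abs_nonneg C)

theorem QuadBounded.add {g h : ℝ → ℝ} (hg : QuadBounded g) (hh : QuadBounded h) :
    QuadBounded fun u => g u + h u := by
  obtain ⟨hc, C, hC⟩ := hg
  obtain ⟨hd, D, hD⟩ := hh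
  refine ⟨hc.add hd, C + D, fun u hu => (abs_add_le _ _).trans ?_⟩
  rw [add_mul]
  exact add_le_add (hC u hu) (hD u hu)

theorem quadBounded_const (C : ℝ) : QuadBounded fun _ => C :=
  ⟨continuousOn_const, |C|, fun u _ => le_mul_of_one_le_right (abs_nonneg C) (by nlinarith)⟩

theorem quadBounded_id : QuadBounded fun u => u :=
  ⟨continuousOn_id, 1, fun u hu => by rw [abs_of_pos hu]; nlinarith [sq_nonneg (u - 1)]⟩

theorem quadBounded_sq : QuadBounded fun u => u ^ 2 :=
  ⟨by fun_prop, 1, fun u hu => by rw [abs_of_nonneg (by positivity)]; nlinarith⟩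

theorem continuousOn_div_add {a : ℝ} (ha : 0 < a) :
    ContinuousOn (fun u : ℝ => u / (a + u)) (Set.Ioi 0) :=
  ContinuousOn.div (by fun_prop) (by fun_prop) fun u hu => by
    have : 0 < u := hu
    positivity

theorem div_add_le_one {a u : ℝ} (ha : 0 < a) (hu : 0 < u) : u / (a + u) ≤ 1 := by
  rw [div_le_one (by positivity)]
  linarith

theorem quadBounded_div_add {a : ℝ} (ha : 0 < a) : QuadBounded fun u => u / (a + u) :=
  ⟨continuousOn_div_add ha, 1, fun u hu => by
    rw [abs_of_nonneg (by positivity)]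
    have := div_add_le_one ha hu
    nlinarith⟩

theorem quadBounded_mul_div_add {a : ℝ} (ha : 0 < a) : QuadBounded fun u => u * (u / (a + u)) :=
  ⟨continuousOn_id.mul (continuousOn_div_add ha), 1, fun u hu => by
    rw [abs_of_nonneg (by positivity)]
    have := div_add_le_one ha hu
    nlinarith [sq_nonneg (u - 1)]⟩

theorem postMean_sum {ι : Type*} (s : Finset ι) {g : ι → ℝ → ℝ} (hg : ∀ i ∈ s, QuadBounded (g i))
    (hrm : ∀ ν, ((m ν : ℝ) - 1) / 2 < r ν) (hβ : 0 < β) (x : Obs m) :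
    postMean r β x (fun u => ∑ i ∈ s, g i u) = ∑ i ∈ s, postMean r β x (g i) := by
  simp_rw [postMean, Finset.sum_mul]
  rw [integral_finsetSum _ fun i hi => (hg i hi).integrableOn hrm hβ x, Finset.sum_div]

theorem QuadBounded.sum {ι : Type*} (s : Finset ι) {g : ι → ℝ → ℝ}
    (hg : ∀ i ∈ s, QuadBounded (g i)) : QuadBounded fun u => ∑ i ∈ s, g i u := by
  classical
  induction s using Finset.induction_on with
  | empty => simpa using quadBounded_const 0
  | insert i s hi ih =>
    simp_rw [Finset.sum_insert hi]
    exact (hg i (Finset.mem_insert_self i s)).add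
      (ih fun j hj => hg j (Finset.mem_insert_of_mem hj))

/-- Moments of the posterior of `u` decrease geometrically with `β`. -/
theorem integral_pow_succ_le (hrm : ∀ ν, ((m ν : ℝ) - 1) / 2 < r ν) (hβ : 0 < β) (x : Obs m)
    (n : ℕ) :
    ∫ u in Set.Ioi (0 : ℝ), u ^ (n + 1) * mixWeight r β x 0 u
      ≤ ((n + 1 : ℕ) : ℝ) / β * ∫ u in Set.Ioi (0 : ℝ), u ^ n * mixWeight r β x 0 u := by
  -- The mean of the Gamma density proportional to `u ^ n * exp (-(β * u))`. Hence `b - u`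
  -- integrates to zero against it, and Chebyshev's argument applies: weighting by the decreasing
  -- marginal mass can only increase that integral.
  set b : ℝ := ((n + 1 : ℕ) : ℝ) / β with hb
  have hb0 : 0 < b := by positivity
  have h1 := integrableOn_mixWeight_mul hrm x 0 hβ (n + 1)
  have h2 := integrableOn_mixWeight_mul hrm x 0 hβ n
  have hI : ∀ k : ℕ, ∫ u in Set.Ioi (0 : ℝ), u ^ k * Real.exp (-(β * u))
      = (1 / β) ^ (k + 1) * k ! := by
    intro k
    have h := Real.integral_rpow_mul_exp_neg_mul_Ioi (a := (k : ℝ) + 1) (r := β) (by positivity) hβ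
    rw [Real.Gamma_nat_eq_factorial, add_sub_cancel_right, ← Nat.cast_succ, Real.rpow_natCast] at h
    simpa using h
  have hJ : ∀ k : ℕ, IntegrableOn (fun u : ℝ => u ^ k * Real.exp (-(β * u))) (Set.Ioi 0) := by
    intro k
    by_contra hi
    have := hI k
    rw [integral_undef hi] at this
    have : 0 < (1 / β) ^ (k + 1) * (k ! : ℝ) := by positivity
    linarith
  have h3 : ∫ u in Set.Ioi (0 : ℝ), (b * (u ^ n * Real.exp (-(β * u)))
      - u ^ (n + 1) * Real.exp (-(β * u))) * marginal r x 0 b = 0 := by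
    rw [integral_mul_const, integral_sub ((hJ n).const_mul b) (hJ (n + 1)), integral_const_mul,
      hI, hI, Nat.factorial_succ]
    refine mul_eq_zero_of_left ?_ _
    rw [hb, pow_succ _ (n + 1)]
    push_cast
    ring
  have h4 : ∫ u in Set.Ioi (0 : ℝ), (b * (u ^ n * Real.exp (-(β * u)))
      - u ^ (n + 1) * Real.exp (-(β * u))) * marginal r x 0 b
      ≤ ∫ u in Set.Ioi (0 : ℝ), (b * (u ^ n * mixWeight r β x 0 u)
        - u ^ (n + 1) * mixWeight r β x 0 u) := by
    refine setIntegral_mono_on ((((hJ n).const_mul b).sub (hJ (n + 1))).mul_const _)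
      ((h2.const_mul b).sub h1) measurableSet_Ioi fun u hu => ?_
    have hu : 0 < u := hu
    have h5 : 0 ≤ (b - u) * (marginal r x 0 u - marginal r x 0 b) := by
      rcases le_total u b with h | h
      · exact mul_nonneg (sub_nonneg.2 h) (sub_nonneg.2 (marginal_antitone hrm x 0 hu.le h))
      · exact mul_nonneg_of_nonpos_of_nonpos (sub_nonpos.2 h)
          (sub_nonpos.2 (marginal_antitone hrm x 0 hb0.le h))
    have h6 : 0 ≤ u ^ n * Real.exp (-(β * u)) * ((b - u) * (marginal r x 0 u - marginal r x 0 b)) :=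
      mul_nonneg (by positivity) h5
    rw [← sub_nonneg, mixWeight]
    refine h6.trans_eq ?_
    ring
  rw [h3, integral_sub (h2.const_mul b) h1, integral_const_mul] at h4
  linarith

end

/-! ### Moment bounds, Jensen's inequality and the unbiased estimate of the gain -/

section

variable {N : ℕ} {m : Fin N → ℕ} {r : Fin N → ℝ} {β : ℝ}

theorem postMean_id_pos (hrm : ∀ ν, ((m ν : ℝ) - 1) / 2 < r ν) (hβ : 0 < β) (x : Obs m) :
    0 < postMean r β x fun u => u := by
  refine div_pos ?_ (integral_mixWeight_pos hrm hβ x 0)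
  simpa using integral_mixWeight_mul_pos hrm x 0 hβ 1

theorem postMean_id_le (hrm : ∀ ν, ((m ν : ℝ) - 1) / 2 < r ν) (hβ : 0 < β) (x : Obs m) :
    postMean r β x (fun u => u) ≤ 1 / β := by
  rw [postMean, div_le_iff₀ (integral_mixWeight_pos hrm hβ x 0)]
  simpa using integral_pow_succ_le hrm hβ x 0

theorem postMean_sq_le (hrm : ∀ ν, ((m ν : ℝ) - 1) / 2 < r ν) (hβ : 0 < β) (x : Obs m) :
    postMean r β x (fun u => u ^ 2) ≤ 2 / β * postMean r β x fun u => u := by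
  rw [postMean, postMean, ← mul_div_assoc]
  refine div_le_div_of_nonneg_right ?_ (integral_mixWeight_pos hrm hβ x 0).le
  have := integral_pow_succ_le hrm hβ x 1
  norm_num at this
  exact this

theorem postMean_div_add_nonneg (hrm : ∀ ν, ((m ν : ℝ) - 1) / 2 < r ν) (hβ : 0 < β) {a : ℝ}
    (ha : 0 < a) (x : Obs m) : 0 ≤ postMean r β x fun u => u / (a + u) := by
  have h := postMean_mono (quadBounded_const 0) (quadBounded_div_add ha)
    (fun u hu => by positivity) hrm hβ x
  rwa [postMean_const hrm hβ] at h

theorem postMean_div_add_le_one (hrm : ∀ ν, ((m ν : ℝ) - 1) / 2 < r ν) (hβ : 0 < β) {a : ℝ}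
    (ha : 0 < a) (x : Obs m) : postMean r β x (fun u => u / (a + u)) ≤ 1 := by
  have h := postMean_mono (quadBounded_div_add ha) (quadBounded_const 1)
    (fun u hu => div_add_le_one ha hu) hrm hβ x
  rwa [postMean_const hrm hβ] at h

/-- The posterior mean of the pointwise bound `u / (a + u) ≥ u / a - u² / a²`. -/
theorem le_postMean_div_add (hrm : ∀ ν, ((m ν : ℝ) - 1) / 2 < r ν) (hβ : 0 < β) {a : ℝ}
    (ha : 0 < a) (x : Obs m) :
    1 / a * postMean r β x (fun u => u) + -(1 / a ^ 2) * postMean r β x (fun u => u ^ 2)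
      ≤ postMean r β x fun u => u / (a + u) := by
  rw [← postMean_const_mul, ← postMean_const_mul,
    ← postMean_add (quadBounded_id.const_mul _) (quadBounded_sq.const_mul _) hrm hβ]
  refine postMean_mono ((quadBounded_id.const_mul _).add (quadBounded_sq.const_mul _))
    (quadBounded_div_add ha) (fun u hu => ?_) hrm hβ x
  rw [le_div_iff₀ (by positivity)]
  have : (1 / a * u + -(1 / a ^ 2) * u ^ 2) * (a + u) = u - u ^ 3 / a ^ 2 := by
    field_simp
    ring
  rw [this]
  have : 0 ≤ u ^ 3 / a ^ 2 := by positivity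
  linarith

theorem postMean_mul_div_add_le (hrm : ∀ ν, ((m ν : ℝ) - 1) / 2 < r ν) (hβ : 0 < β) {a : ℝ}
    (ha : 0 < a) (x : Obs m) :
    postMean r β x (fun u => u * (u / (a + u))) ≤ 1 / a * postMean r β x fun u => u ^ 2 := by
  rw [← postMean_const_mul]
  refine postMean_mono (quadBounded_mul_div_add ha) (quadBounded_sq.const_mul _) (fun u hu => ?_)
    hrm hβ x
  rw [← mul_div_assoc, one_div_mul_eq_div, ← sq]
  gcongr
  linarith

theorem postMean_gainAt (hrm : ∀ ν, ((m ν : ℝ) - 1) / 2 < r ν) (hβ : 0 < β) (x : Obs m)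
    {a : Fin N → ℝ} (ha : ∀ ν, 0 < a ν) (n : Fin N → ℕ) (c : (ν : Fin N) → Fin (m ν + 1) → ℕ) :
    QuadBounded (gainAt a n r x c) ∧ postMean r β x (gainAt a n r x c)
      = ∑ ν, ((c ν 0 : ℝ) * postMean r β x (fun u => u / (a ν + u))
        - n ν * (postMean r β x (fun u => u) / postSum r x ν)) := by
  have h1 : gainAt a n r x c = fun u => ∑ ν, ((c ν 0 : ℝ) * (u / (a ν + u))
      + -(n ν / postSum r x ν) * u) := by
    funext u
    refine Finset.sum_congr rfl fun ν _ => ?_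
    ring
  have h2 : ∀ ν ∈ Finset.univ, QuadBounded fun u => (c ν 0 : ℝ) * (u / (a ν + u))
      + -(n ν / postSum r x ν) * u := fun ν _ =>
    ((quadBounded_div_add (ha ν)).const_mul _).add (quadBounded_id.const_mul _)
  rw [h1]
  refine ⟨QuadBounded.sum _ h2, ?_⟩
  rw [postMean_sum _ h2 hrm hβ]
  refine Finset.sum_congr rfl fun ν _ => ?_
  rw [postMean_add ((quadBounded_div_add (ha ν)).const_mul _) (quadBounded_id.const_mul _) hrm hβ,
    postMean_const_mul, postMean_const_mul]
  ring

/-- Jensen's inequality for the ratio of the two predictive masses. -/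
theorem marginal_ratio_mul_exp_le (hr : ∀ ν, 0 < r ν) (hrm : ∀ ν, ((m ν : ℝ) - 1) / 2 < r ν)
    (hβ : 0 < β) (x : Obs m) {c : (ν : Fin N) → Fin (m ν + 1) → ℕ} {n : Fin N → ℕ}
    (hc : ∀ ν, ∑ j, c ν j = n ν) {a : Fin N → ℝ} (ha0 : ∀ ν, 0 < a ν)
    (ha : ∀ ν, ∀ k < n ν, (1 - (m ν : ℝ)) / 2 + r ν + k ≤ a ν) :
    marginal r x c 0 / marginal r x 0 0 * Real.exp (postMean r β x (gainAt a n r x c))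
      ≤ (∫ u in Set.Ioi (0 : ℝ), mixWeight r β x c u)
        / ∫ u in Set.Ioi (0 : ℝ), mixWeight r β x 0 u := by
  obtain ⟨hq, -⟩ := postMean_gainAt hrm hβ x ha0 n c
  set G := gainAt a n r x c with hG
  set g := postMean r β x G with hg
  set q := marginal r x c 0 / marginal r x 0 0 with hqdef
  have hq0 : 0 < q := div_pos (marginal_pos hrm x c le_rfl) (marginal_pos hrm x 0 le_rfl)
  have hI := integral_mixWeight_pos hrm hβ x 0
  have hlin : QuadBounded fun u => (1 - g) + G u := (quadBounded_const (1 - g)).add hq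
  -- Jensen's inequality through the tangent line of `exp` at the mean `g`: `exp G ≥ exp g * (1 + G
  -- - g)`, where the second factor has posterior mean `1`.
  have h1 : postMean r β x (fun u => (1 - g) + G u) = 1 := by
    rw [postMean_add (quadBounded_const _) hq hrm hβ, postMean_const hrm hβ, ← hg]
    ring
  rw [postMean, div_eq_one_iff_eq hI.ne'] at h1
  rw [le_div_iff₀ hI, ← h1, ← integral_const_mul]
  have hci := integrableOn_mixWeight_mul hrm x c hβ 0
  simp only [pow_zero, one_mul] at hci
  refine setIntegral_mono_on ((hlin.integrableOn hrm hβ x).const_mul _) hci measurableSet_Ioi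
    fun u hu => ?_
  have hu : 0 ≤ u := le_of_lt hu
  have h2 := marginal_ratio_le hr hrm x hc ha hu
  have h3 : Real.exp g * ((1 - g) + G u) ≤ Real.exp (G u) := by
    have h4 := Real.add_one_le_exp (G u - g)
    calc _ ≤ Real.exp g * Real.exp (G u - g) :=
          mul_le_mul_of_nonneg_left (by linarith) (Real.exp_pos g).le
      _ = _ := by rw [← Real.exp_add]; ring_nf
  have hm := marginal_pos hrm x 0 hu
  have he := Real.exp_pos (-(β * u))
  unfold mixWeight
  calc q * Real.exp g * (((1 - g) + G u) * (Real.exp (-(β * u)) * marginal r x 0 u))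
      = Real.exp (-(β * u)) * (q * (Real.exp g * ((1 - g) + G u)) * marginal r x 0 u) := by ring
    _ ≤ Real.exp (-(β * u)) * (q * Real.exp (G u) * marginal r x 0 u) := by gcongr
    _ ≤ _ := mul_le_mul_of_nonneg_left h2 he.le

/-- The mean of `u / (a + u)` under the posterior given one count less in the `ν`-th vector. -/
noncomputable def prevMean (r : Fin N → ℝ) (β a : ℝ) (ν : Fin N) (x : Obs m) : ℝ :=
  postMean r β x (fun u => (postSum r x ν - 1 + u) * (u / (a + u)))
    / postMean r β x fun u => postSum r x ν - 1 + u

/-- By `mixWeight_bump`, tilting the posterior at `x + eᵢ` by `postSum r x ν + u` gives back the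
posterior at `x`. The `- 1` in `prevMean` undoes the increment of `postSum`, so one function serves
every cell `i`. -/
theorem prevMean_bump (hr : ∀ ν, 0 < r ν) (hrm : ∀ ν, ((m ν : ℝ) - 1) / 2 < r ν)
    (hβ : 0 < β) (a : ℝ) (x : Obs m) (ν : Fin N) (i : Fin (m ν)) :
    prevMean r β a ν (bump ν i x) = postMean r β x fun u => u / (a + u) := by
  have h1 : postSum r (bump ν i x) ν - 1 = postSum r x ν := by
    rw [postSum, postSum, total_bump_self]
    ring
  have hI := (integral_mixWeight_pos hrm hβ (bump ν i x) 0).ne'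
  rw [prevMean, h1, postMean, postMean, postMean, div_div_div_cancel_right₀ hI]
  have h2 : ∫ u in Set.Ioi (0 : ℝ), (postSum r x ν + u) * mixWeight r β (bump ν i x) 0 u
      = (x ν i + 1 / 2) * ∫ u in Set.Ioi (0 : ℝ), mixWeight r β x 0 u := by
    rw [← integral_const_mul]
    exact setIntegral_congr_fun measurableSet_Ioi fun u hu =>
      mixWeight_bump hr hrm x ν i (le_of_lt hu)
  have h3 : ∫ u in Set.Ioi (0 : ℝ), (postSum r x ν + u) * (u / (a + u))
        * mixWeight r β (bump ν i x) 0 u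
      = (x ν i + 1 / 2) * ∫ u in Set.Ioi (0 : ℝ), u / (a + u) * mixWeight r β x 0 u := by
    rw [← integral_const_mul]
    refine setIntegral_congr_fun measurableSet_Ioi fun u hu => ?_
    have := mixWeight_bump (β := β) hr hrm x ν i (le_of_lt hu)
    linear_combination (u / (a + u)) * this
  rw [h2, h3, mul_div_mul_left _ _ (by positivity)]

/-- Expanding the tilt gives `(T - 1) F + Q` over `T - 1 + M₁`, with `Q` the posterior mean of `u *
(u / (a + u))`. The term `M₁ ≥ 0` of the denominator may be dropped. -/
theorem prevMean_le (hrm : ∀ ν, ((m ν : ℝ) - 1) / 2 < r ν)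
    (hβ : 0 < β) {a : ℝ} (ha : 0 < a) (x : Obs m) (ν : Fin N) (hT : 0 < postSum r x ν - 1) :
    prevMean r β a ν x ≤ postMean r β x (fun u => u / (a + u))
      + postMean r β x (fun u => u * (u / (a + u))) / (postSum r x ν - 1) := by
  have h1 : postMean r β x (fun u => (postSum r x ν - 1 + u) * (u / (a + u)))
      = (postSum r x ν - 1) * postMean r β x (fun u => u / (a + u))
        + postMean r β x (fun u => u * (u / (a + u))) := by
    simp_rw [add_mul]
    rw [postMean_add ((quadBounded_div_add ha).const_mul _) (quadBounded_mul_div_add ha) hrm hβ,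
      postMean_const_mul]
  have h2 : postMean r β x (fun u => postSum r x ν - 1 + u)
      = postSum r x ν - 1 + postMean r β x fun u => u := by
    rw [postMean_add (quadBounded_const _) quadBounded_id hrm hβ, postMean_const hrm hβ]
  have h3 := postMean_id_pos hrm hβ x
  have h4 := postMean_div_add_nonneg hrm hβ ha x
  have h5 : 0 ≤ postMean r β x (fun u => u * (u / (a + u))) := by
    have h := postMean_mono (quadBounded_const 0) (quadBounded_mul_div_add ha)
      (fun u hu => by positivity) hrm hβ x
    rwa [postMean_const hrm hβ] at h
  rw [prevMean, h1, h2]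
  calc _ ≤ ((postSum r x ν - 1) * postMean r β x (fun u => u / (a + u))
        + postMean r β x (fun u => u * (u / (a + u)))) / (postSum r x ν - 1) := by
        gcongr
        linarith
    _ = _ := by
        rw [add_div, mul_div_cancel_left₀ _ hT.ne']

/-- The unbiased estimate of the gain due to the `ν`-th vector is positive. -/
theorem gain_estimate_pos (hrm : ∀ ν, ((m ν : ℝ) - 1) / 2 < r ν)
    (hβ : 0 < β) {a : ℝ} (ha : 0 < a) (x : Obs m) (ν : Fin N) (hr1 : 1 < r ν)
    (hβa : ((r ν - 1) / a ^ 2 + 1 / a) * (2 / β) < (r ν - 1) / a - 1) :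
    0 < postMean r β x (fun u => u / (a + u))
      - total x ν / (r ν + total x ν - 1) * prevMean r β a ν x
      - postMean r β x (fun u => u) / postSum r x ν := by
  have ht := total_nonneg x ν
  set t := total x ν
  have hT : postSum r x ν = r ν + t + 1 / 2 := rfl
  have hT1 : 0 < postSum r x ν - 1 := by rw [hT]; linarith
  have hD : 0 < r ν + t - 1 := by linarith
  have h1 := prevMean_le hrm hβ ha x ν hT1
  have h2 := postMean_mul_div_add_le hrm hβ ha x
  have h3 := le_postMean_div_add hrm hβ ha x
  have h4 := postMean_sq_le hrm hβ x
  have h5 := postMean_id_pos hrm hβ x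
  have h6 : 0 ≤ postMean r β x (fun u => u * (u / (a + u))) := by
    have h := postMean_mono (quadBounded_const 0) (quadBounded_mul_div_add ha)
      (fun u hu => by positivity) hrm hβ x
    rwa [postMean_const hrm hβ] at h
  set M1 := postMean r β x fun u => u
  set M2 := postMean r β x fun u => u ^ 2
  set F := postMean r β x fun u => u / (a + u)
  set Q := postMean r β x fun u => u * (u / (a + u))
  -- Here `t ≤ T - 1 = r + t - 1 / 2`.
  have h7 : t * (Q / (postSum r x ν - 1)) ≤ Q := by
    rw [mul_div_assoc', div_le_iff₀ hT1, mul_comm]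
    refine mul_le_mul_of_nonneg_left ?_ h6
    rw [hT]
    linarith
  have h8 : M1 / postSum r x ν ≤ M1 / (r ν + t - 1) := by
    gcongr
    rw [hT]
    linarith
  have h9 : t / (r ν + t - 1) * prevMean r β a ν x ≤ (t * F + Q) / (r ν + t - 1) := by
    rw [div_mul_eq_mul_div]
    refine div_le_div_of_nonneg_right ?_ hD.le
    calc _ ≤ t * (F + Q / (postSum r x ν - 1)) := mul_le_mul_of_nonneg_left h1 ht
      _ ≤ _ := by rw [mul_add]; linarith
  -- `M₂ ≤ (2 / β) M₁` makes the second-order term negligible next to the first-order one; this is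
  -- what the condition on `β` is for.
  have h10 : 0 < (((r ν - 1) / a - 1) * M1 - ((r ν - 1) / a ^ 2 + 1 / a) * M2) := by
    have hC : 0 ≤ (r ν - 1) / a ^ 2 + 1 / a := by
      have : 0 < r ν - 1 := by linarith
      positivity
    have e1 := mul_le_mul_of_nonneg_left h4 hC
    have e2 := mul_lt_mul_of_pos_right hβa h5
    linarith
  have h11 : (((r ν - 1) / a - 1) * M1 - ((r ν - 1) / a ^ 2 + 1 / a) * M2)
      ≤ (r ν - 1) * F - Q - M1 := by
    have e1 := mul_le_mul_of_nonneg_left h3 (show 0 ≤ r ν - 1 by linarith)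
    have e2 : (r ν - 1) * (1 / a * M1 + -(1 / a ^ 2) * M2) - 1 / a * M2 - M1
        = (((r ν - 1) / a - 1) * M1 - ((r ν - 1) / a ^ 2 + 1 / a) * M2) := by ring
    linarith
  have h12 : F - (t * F + Q) / (r ν + t - 1) - M1 / (r ν + t - 1)
      = ((r ν - 1) * F - Q - M1) / (r ν + t - 1) := by
    field_simp
    ring
  have h13 := div_pos (h10.trans_le h11) hD
  linarith

/-- The expected gain due to the `ν`-th vector is positive. -/
theorem exists_hasSum_gain {p : Param m} (hr : ∀ ν, 0 < r ν)
    (hrm : ∀ ν, ((m ν : ℝ) - 1) / 2 < r ν) (hp : p ∈ paramSpace m)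
    (hβ : 0 < β) {a : ℝ} (ha : 0 < a) (ν : Fin N) (hr1 : 1 < r ν)
    (hβa : ((r ν - 1) / a ^ 2 + 1 / a) * (2 / β) < (r ν - 1) / a - 1) :
    ∃ S, 0 < S ∧ HasSum (fun x => obsMass r p x * (zeroProb (p ν)
      * postMean r β x (fun u => u / (a + u))
      - postMean r β x (fun u => u) / postSum r x ν)) S := by
  have hm := (hasSum_obsMass hr hp).summable
  have hmp := fun x => obsMass_pos hr hp x
  have hbdd : ∀ {g : Obs m → ℝ} (C : ℝ), (∀ x, 0 ≤ g x) → (∀ x, g x ≤ C) →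
      Summable fun x => obsMass r p x * g x := by
    intro g C h0 h1
    exact Summable.of_nonneg_of_le (fun x => mul_nonneg (hmp x).le (h0 x))
      (fun x => mul_le_mul_of_nonneg_left (h1 x) (hmp x).le) (hm.mul_right C)
  have hF : Summable fun x => obsMass r p x * postMean r β x (fun u => u / (a + u)) :=
    hbdd 1 (postMean_div_add_nonneg hrm hβ ha) (postMean_div_add_le_one hrm hβ ha)
  have hM : Summable fun x => obsMass r p x
      * (postMean r β x (fun u => u) / postSum r x ν) := by
    refine hbdd (1 / β) (fun x => div_nonneg (postMean_id_pos hrm hβ x).le (postSum_pos hr x ν).le)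
      fun x => ?_
    have hT : 1 ≤ postSum r x ν := by
      have := total_nonneg x ν
      unfold postSum
      linarith
    exact (div_le_self (postMean_id_pos hrm hβ x).le hT).trans (postMean_id_le hrm hβ x)
  -- The Stein-type identity removes the unknown `p ν i`. The sum over `i` then turns the
  -- coefficients into `total x ν / (r ν + total x ν - 1)`.
  have hs : ∀ i, HasSum (fun x => obsMass r p x
      * (x ν i / (r ν + total x ν - 1) * prevMean r β a ν x))
      (p ν i * ∑' x, obsMass r p x * postMean r β x (fun u => u / (a + u))) := by
    intro i
    rw [← hasSum_mul_bump_iff hr ν i (prevMean r β a ν)]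
    simp_rw [prevMean_bump hr hrm hβ, mul_left_comm (obsMass r p _)]
    exact hF.hasSum.mul_left _
  have hs2 := hasSum_sum (s := Finset.univ) fun i _ => hs i
  rw [← Finset.sum_mul] at hs2
  have hE := (hF.hasSum.sub hs2).sub hM.hasSum
  have hz : zeroProb (p ν) = 1 - ∑ i, p ν i := rfl
  have hV := ((hF.hasSum.mul_left (zeroProb (p ν))).sub hM.hasSum)
  refine ⟨_, ?_, (congrArg (fun f => HasSum f _) (funext fun x => ?_)).mp hV⟩
  · rw [hz, sub_mul, one_mul, ← hE.tsum_eq]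
    have hpos : ∀ x, 0 < obsMass r p x * postMean r β x (fun u => u / (a + u))
        - ∑ i, obsMass r p x * (x ν i / (r ν + total x ν - 1) * prevMean r β a ν x)
        - obsMass r p x * (postMean r β x (fun u => u) / postSum r x ν) := by
      intro x
      have h := mul_pos (hmp x) (gain_estimate_pos hrm hβ ha x ν hr1 hβa)
      rw [← Finset.mul_sum, ← Finset.sum_mul, ← Finset.sum_div]
      change 0 < _ - obsMass r p x * (total x ν / _ * _) - _
      linarith
    exact hE.summable.tsum_pos (fun x => (hpos x).le) 0 (hpos 0)
  · ring

end

/-! ### Integrability of the losses and comparison of the risks -/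

section Tables

variable {N L : ℕ} {m : Fin N → ℕ} {d : Fin L → ℕ} {idx : (t : Fin L) → Fin (d t) → Fin N}
  {l : Fin L → ℕ} {r : Fin N → ℝ} {p : Param m} {β : ℝ}

/-- The risk of a positive predictive mass whose logarithmic loss is integrable. -/
theorem risk_eq (hr : ∀ ν, 0 < r ν) (hp : p ∈ paramSpace m) {G : Obs m → Tables m idx l → ℝ}
    (hG : ∀ x w, 0 < G x w)
    (hs : Summable fun z : Obs m × Tables m idx l => obsMass r p z.1 * tableMass idx l p z.2
      * Real.log (tableMass idx l p z.2 / G z.1 z.2)) :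
    risk r (fun x w => ENNReal.ofReal (G x w)) p
      = ((∑' z : Obs m × Tables m idx l, obsMass r p z.1 * tableMass idx l p z.2
        * Real.log (tableMass idx l p z.2 / G z.1 z.2) : ℝ) : EReal) := by
  have hq : ∀ z : Obs m × Tables m idx l, 0 < obsMass r p z.1 * tableMass idx l p z.2 := fun z =>
    mul_pos (obsMass_pos hr hp _) (tableMass_pos hp _)
  have h1 : ∀ z : Obs m × Tables m idx l, logLoss (fun x w => ENNReal.ofReal (G x w)) p z.1 z.2
      = ((Real.log (tableMass idx l p z.2 / G z.1 z.2) : ℝ) : EReal) := by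
    intro z
    rw [logLoss, ← ENNReal.ofReal_div_of_pos (hG _ _),
      ENNReal.log_ofReal_of_pos (div_pos (tableMass_pos hp _) (hG _ _))]
  have key : ∀ {Λ : Obs m × Tables m idx l → ℝ},
      Summable (fun z => obsMass r p z.1 * tableMass idx l p z.2 * Λ z) →
      ∑' z : Obs m × Tables m idx l, ENNReal.ofReal (obsMass r p z.1 * tableMass idx l p z.2)
        * ((Λ z : ℝ) : EReal).toENNReal
      = ENNReal.ofReal (∑' z, max (obsMass r p z.1 * tableMass idx l p z.2 * Λ z) 0) := by
    intro Λ hΛ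
    have hmax : ∀ z, 0 ≤ max (obsMass r p z.1 * tableMass idx l p z.2 * Λ z) 0 := fun z =>
      le_max_right _ _
    rw [ENNReal.ofReal_tsum_of_nonneg hmax]
    · refine tsum_congr fun z => ?_
      rw [EReal.toENNReal_of_ne_top (EReal.coe_ne_top _), EReal.toReal_coe,
        ← ENNReal.ofReal_mul (hq z).le]
      rcases le_total 0 (obsMass r p z.1 * tableMass idx l p z.2 * Λ z) with h | h
      · rw [max_eq_left h]
      · rw [max_eq_right h, ENNReal.ofReal_zero, ENNReal.ofReal_of_nonpos h]
    · exact Summable.of_nonneg_of_le hmax (fun z => max_le (le_abs_self _) (abs_nonneg _)) hΛ.abs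
  have hs' : Summable fun z : Obs m × Tables m idx l => obsMass r p z.1 * tableMass idx l p z.2
      * -Real.log (tableMass idx l p z.2 / G z.1 z.2) := by
    simpa only [mul_neg] using hs.neg
  have hmax : ∀ {f : Obs m × Tables m idx l → ℝ}, Summable f → Summable fun z => max (f z) 0 :=
    fun hf => Summable.of_nonneg_of_le (fun z => le_max_right _ _)
      (fun z => max_le (le_abs_self _) (abs_nonneg _)) hf.abs
  rw [risk]
  simp_rw [h1, ← EReal.coe_neg]
  rw [key hs, key hs', EReal.coe_ennreal_ofReal, EReal.coe_ennreal_ofReal,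
    max_eq_left (tsum_nonneg fun z => le_max_right _ _),
    max_eq_left (tsum_nonneg fun z => le_max_right _ _), ← EReal.coe_sub,
    ← (hmax hs).tsum_sub (hmax hs')]
  congr 2
  funext z
  rw [mul_neg, max_zero_sub_max_neg_zero_eq_self]

/-- Strict comparison of risks from a lower bound for the logarithm of the ratio of two masses. -/
theorem risk_lt_risk (hr : ∀ ν, 0 < r ν) (hp : p ∈ paramSpace m)
    {G G' : Obs m → Tables m idx l → ℝ} (hG : ∀ x w, 0 < G x w) (hG' : ∀ x w, 0 < G' x w)
    {b : Obs m → ℝ} (hb0 : ∀ x, 0 ≤ b x) (hb : Summable fun x => obsMass r p x * b x)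
    (hGb : ∀ x w, |Real.log (G x w)| ≤ b x) (hGb' : ∀ x w, |Real.log (G' x w)| ≤ b x)
    {D : Obs m → Tables m idx l → ℝ} (hD : ∀ x w, G x w * Real.exp (D x w) ≤ G' x w)
    {S : ℝ} (hS : 0 < S)
    (hDS : HasSum (fun x => obsMass r p x * ∑ w, tableMass idx l p w * D x w) S) :
    risk r (fun x w => ENNReal.ofReal (G' x w)) p < risk r (fun x w => ENNReal.ofReal (G x w)) p := by
  have ho := fun x => obsMass_pos hr hp x
  have ht := fun w : Tables m idx l => tableMass_pos hp w
  have hm := (hasSum_obsMass hr hp).summable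
  have hsum : ∀ {H : Obs m → Tables m idx l → ℝ}, (∀ x w, 0 < H x w) →
      (∀ x w, |Real.log (H x w)| ≤ b x) →
      Summable fun z : Obs m × Tables m idx l => obsMass r p z.1 * tableMass idx l p z.2
        * Real.log (tableMass idx l p z.2 / H z.1 z.2) := by
    intro H hH hHb
    set K := ∑ w : Tables m idx l, |Real.log (tableMass idx l p w)|
    have hK : 0 ≤ K := Finset.sum_nonneg fun w _ => abs_nonneg _
    have hKw : ∀ w : Tables m idx l, |Real.log (tableMass idx l p w)| ≤ K := fun w =>
      Finset.single_le_sum (f := fun w : Tables m idx l => |Real.log (tableMass idx l p w)|)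
        (fun w _ => abs_nonneg _) (Finset.mem_univ w)
    have h1 : Summable fun z : Obs m × Tables m idx l =>
        (obsMass r p z.1 * K + obsMass r p z.1 * b z.1) * tableMass idx l p z.2 := by
      refine Summable.mul_of_nonneg ((hm.mul_right K).add hb) Summable.of_finite (fun x => ?_)
        fun w => (ht w).le
      exact add_nonneg (mul_nonneg (ho x).le hK) (mul_nonneg (ho x).le (hb0 x))
    refine h1.of_norm_bounded fun z => ?_
    have hq := mul_pos (ho z.1) (ht z.2)
    have h2 : |Real.log (tableMass idx l p z.2) - Real.log (H z.1 z.2)| ≤ K + b z.1 := by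
      rw [← Real.norm_eq_abs]
      exact (norm_sub_le _ _).trans (add_le_add (hKw _) (hHb _ _))
    rw [norm_mul, Real.norm_of_nonneg hq.le, Real.norm_eq_abs,
      Real.log_div (ht _).ne' (hH _ _).ne']
    calc _ ≤ obsMass r p z.1 * tableMass idx l p z.2 * (K + b z.1) :=
          mul_le_mul_of_nonneg_left h2 hq.le
      _ = _ := by ring
  have h1 := hsum hG hGb
  have h2 := hsum hG' hGb'
  rw [risk_eq hr hp hG h1, risk_eq hr hp hG' h2, EReal.coe_lt_coe_iff, ← sub_pos]
  -- Both losses are summable, so the risk difference can be summed over the finitely many tables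
  -- first and compared with `S` observation by observation.
  have h3 := (h1.hasSum.sub h2.hasSum).prod_fiberwise fun x => hasSum_fintype _
  refine hS.trans_le (hasSum_le (fun x => ?_) hDS h3)
  rw [Finset.mul_sum]
  refine Finset.sum_le_sum fun w _ => ?_
  rw [Real.log_div (ht _).ne' (hG _ _).ne', Real.log_div (ht _).ne' (hG' _ _).ne']
  have h4 := Real.log_le_log (mul_pos (hG x w) (Real.exp_pos _)) (hD x w)
  rw [Real.log_mul (hG x w).ne' (Real.exp_pos _).ne', Real.log_exp] at h4
  have h5 := mul_le_mul_of_nonneg_left (show D x w ≤ Real.log (G' x w) - Real.log (G x w) by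
    linarith) (mul_pos (ho x) (ht w)).le
  simp only
  linarith

theorem summable_obsMass_mul_postSum (hr : ∀ ν, 0 < r ν) (hp : p ∈ paramSpace m) (ν : Fin N) :
    Summable fun x => obsMass r p x * postSum r x ν := by
  have hm := (hasSum_obsMass hr hp).summable
  have h1 : Summable fun x => ∑ i, obsMass r p x * x ν i :=
    summable_sum fun i _ => (hasSum_count hr hp ν i).summable
  have h2 := h1.add (hm.mul_right (r ν + 1 / 2))
  refine h2.congr fun x => ?_
  rw [← Finset.mul_sum, postSum, total]
  ring

theorem pow_le_rise {s y : ℝ} (hs : 0 ≤ s) (hsy : s ≤ y) (n : ℕ) : s ^ n ≤ rise y n := by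
  rw [rise, ← Finset.card_range n, ← Finset.prod_const, Finset.card_range]
  refine Finset.prod_le_prod (fun _ _ => hs) fun k _ => ?_
  have : (0 : ℝ) ≤ k := k.cast_nonneg
  linarith

theorem rise_le_exp {y : ℝ} (hy : 0 < y) (n : ℕ) : rise y n ≤ Real.exp (n * (y + n)) := by
  rw [Real.exp_nat_mul, ← Finset.card_range n, ← Finset.prod_const, Finset.card_range, rise]
  refine Finset.prod_le_prod (fun k _ => by positivity) fun k hk => ?_
  have h1 := Real.add_one_le_exp (y + n)
  have h2 : (k : ℝ) ≤ n := by exact_mod_cast (Finset.mem_range.1 hk).le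
  linarith

/-- The Bayesian predictive mass with respect to the Jeffreys prior, as a real number. -/
noncomputable def dirichletMass (r : Fin N → ℝ) (x : Obs m) (w : Tables m idx l) : ℝ :=
  tableCoef w * (marginal r x (expo w) 0 / marginal r x 0 0)

/-- The Bayesian predictive mass with respect to the shrinkage prior, as a real number. -/
noncomputable def shrinkageMass (r : Fin N → ℝ) (β : ℝ) (x : Obs m) (w : Tables m idx l) : ℝ :=
  tableCoef w * ((∫ u in Set.Ioi (0 : ℝ), mixWeight r β x (expo w) u)
    / ∫ u in Set.Ioi (0 : ℝ), mixWeight r β x 0 u)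

theorem dirichletMass_pos (hrm : ∀ ν, ((m ν : ℝ) - 1) / 2 < r ν) (x : Obs m)
    (w : Tables m idx l) : 0 < dirichletMass r x w :=
  mul_pos (tableCoef_pos w) (div_pos (marginal_pos hrm x _ le_rfl) (marginal_pos hrm x _ le_rfl))

theorem shrinkageMass_pos (hrm : ∀ ν, ((m ν : ℝ) - 1) / 2 < r ν) (hβ : 0 < β) (x : Obs m)
    (w : Tables m idx l) : 0 < shrinkageMass r β x w :=
  mul_pos (tableCoef_pos w)
    (div_pos (integral_mixWeight_pos hrm hβ x _) (integral_mixWeight_pos hrm hβ x _))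

theorem le_one_of_isPredictiveMass {g : Obs m → Tables m idx l → ℝ≥0∞} (hg : IsPredictiveMass g)
    {G : Obs m → Tables m idx l → ℝ} (h : ∀ x w, g x w = ENNReal.ofReal (G x w)) (x : Obs m)
    (w : Tables m idx l) : G x w ≤ 1 := by
  have h1 := ENNReal.le_tsum (f := g x) w
  rw [hg x, h] at h1
  exact ENNReal.ofReal_le_one.1 h1

/-- Rising factorials in the numerator are bounded below by constants and those in the denominator
above by exponentials linear in the counts. The log loss therefore grows at most linearly in the
counts, which have finite means. -/
theorem exists_neg_log_dirichletMass_le (hidx : ∀ t, StrictMono (idx t)) (hr : ∀ ν, 0 < r ν)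
    (hrm : ∀ ν, ((m ν : ℝ) - 1) / 2 < r ν) :
    ∃ K, ∀ x (w : Tables m idx l), -Real.log (dirichletMass r x w)
      ≤ K + ∑ ν, trials idx l ν * postSum r x ν := by
  -- A lower bound, uniform in `x`, of the posterior parameters at `u = 0`: the first entry serves
  -- the cells `i ≥ 1`, the second the zero cell.
  let s : Fin N → ℝ := fun ν => min (1 / 2) ((1 - (m ν : ℝ)) / 2 + r ν)
  have hs : ∀ ν, 0 < s ν := fun ν => lt_min (by norm_num) (by have := hrm ν; linarith)
  refine ⟨∑ w : Tables m idx l, |Real.log (tableCoef w)|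
    + ∑ ν, (trials idx l ν * trials idx l ν - trials idx l ν * Real.log (s ν)), fun x w => ?_⟩
  have hp := postPar_pos hrm x 0 le_rfl
  have hw := tableCoef_pos w
  have h1 : tableCoef w * ∏ ν, (s ν ^ trials idx l ν
      / Real.exp (trials idx l ν * (postSum r x ν + trials idx l ν))) ≤ dirichletMass r x w := by
    rw [dirichletMass, marginal_eq hrm x _ le_rfl,
      mul_div_cancel_left₀ _ (marginal_pos hrm x 0 le_rfl).ne']
    refine mul_le_mul_of_nonneg_left (Finset.prod_le_prod (fun ν _ => ?_) fun ν _ => ?_) hw.le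
    · have := hs ν
      positivity
    · have hT := postSum_pos hr x ν
      rw [zero_add, sum_expo hidx]
      refine div_le_div₀ (Finset.prod_nonneg fun j _ => (rise_pos (hp ν j) _).le) ?_
        (rise_pos hT _) (rise_le_exp hT _)
      rw [← sum_expo hidx w ν, ← Finset.prod_pow_eq_pow_sum]
      refine Finset.prod_le_prod (fun j _ => pow_nonneg (hs ν).le _) fun j _ =>
        pow_le_rise (hs ν).le ?_ _
      refine Fin.cases ?_ (fun i => ?_) j
      · simp [postPar, s]
      · refine (min_le_left _ _).trans ?_
        simp [postPar]
  have h2 : ∀ ν, 0 < s ν ^ trials idx l ν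
      / Real.exp (trials idx l ν * (postSum r x ν + trials idx l ν)) := fun ν => by
    have := hs ν
    positivity
  have h3 := Real.log_le_log (mul_pos hw (Finset.prod_pos fun ν _ => h2 ν)) h1
  rw [Real.log_mul hw.ne' (Finset.prod_pos fun ν _ => h2 ν).ne',
    Real.log_prod fun ν _ => (h2 ν).ne'] at h3
  have h4 : ∀ ν, Real.log (s ν ^ trials idx l ν
      / Real.exp (trials idx l ν * (postSum r x ν + trials idx l ν)))
      = -(trials idx l ν * trials idx l ν - trials idx l ν * Real.log (s ν))
        - trials idx l ν * postSum r x ν := by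
    intro ν
    rw [Real.log_div (pow_pos (hs ν) _).ne' (Real.exp_pos _).ne', Real.log_pow, Real.log_exp]
    ring
  simp_rw [h4] at h3
  rw [Finset.sum_sub_distrib, Finset.sum_neg_distrib] at h3
  have h5 : |Real.log (tableCoef w)| ≤ ∑ w : Tables m idx l, |Real.log (tableCoef w)| :=
    Finset.single_le_sum (f := fun w : Tables m idx l => |Real.log (tableCoef w)|)
      (fun w _ => abs_nonneg _) (Finset.mem_univ w)
  have h6 := neg_abs_le (Real.log (tableCoef w))
  linarith

/-- The bound for the parameter of the `ν`-th vector in the estimate of the gain. -/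
noncomputable def gainPar (idx : (t : Fin L) → Fin (d t) → Fin N) (l : Fin L → ℕ) (m : Fin N → ℕ)
    (r : Fin N → ℝ) (ν : Fin N) : ℝ :=
  -- The largest `A + k` with `k < trials`. The subtraction is truncated, so that the value stays
  -- positive for a vector without trials.
  (1 - (m ν : ℝ)) / 2 + r ν + (trials idx l ν - 1 : ℕ)

theorem gainPar_pos (hrm : ∀ ν, ((m ν : ℝ) - 1) / 2 < r ν) (ν : Fin N) :
    0 < gainPar idx l m r ν := by
  have := hrm ν
  have h : 0 < (1 - (m ν : ℝ)) / 2 + r ν := by linarith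
  unfold gainPar
  positivity

theorem dirichletMass_mul_exp_le (hidx : ∀ t, StrictMono (idx t)) (hr : ∀ ν, 0 < r ν)
    (hrm : ∀ ν, ((m ν : ℝ) - 1) / 2 < r ν) (hβ : 0 < β) (x : Obs m) (w : Tables m idx l) :
    dirichletMass r x w * Real.exp (∑ ν, ((expo w ν 0 : ℝ)
        * postMean r β x (fun u => u / (gainPar idx l m r ν + u))
        - trials idx l ν * (postMean r β x (fun u => u) / postSum r x ν)))
      ≤ shrinkageMass r β x w := by
  have hg := gainPar_pos (idx := idx) (l := l) hrm
  rw [← (postMean_gainAt hrm hβ x hg (trials idx l) (expo w)).2, dirichletMass, shrinkageMass,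
    mul_assoc]
  refine mul_le_mul_of_nonneg_left (marginal_ratio_mul_exp_le hr hrm hβ x
    (fun ν => sum_expo hidx w ν) hg fun ν k hk => ?_) (tableCoef_pos w).le
  have : (k : ℝ) ≤ (trials idx l ν - 1 : ℕ) := by
    exact_mod_cast Nat.le_sub_one_of_lt hk
  unfold gainPar
  linarith

/-- The gain bound averages, over `w` and then over `x`, to a sum of nonnegative contributions of
the vectors, positive for those with trials. Strictness thus holds at every `p`. -/
theorem risk_shrinkage_lt (hidx : ∀ t, StrictMono (idx t)) (hr : ∀ ν, 1 ≤ r ν)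
    (hrm : ∀ ν, ((m ν : ℝ) - 1) / 2 < r ν) (hβ : 0 < β) (hp : p ∈ paramSpace m)
    (hr1 : ∀ ν, 1 ≤ trials idx l ν → 1 < r ν) (hex : ∃ ν, 1 ≤ trials idx l ν)
    (hβa : ∀ ν, 1 ≤ trials idx l ν →
      ((r ν - 1) / gainPar idx l m r ν ^ 2 + 1 / gainPar idx l m r ν) * (2 / β)
        < (r ν - 1) / gainPar idx l m r ν - 1) :
    risk r (bayesMass r idx l (shrinkagePrior (m := m) 1 β (fun _ => 1)
        (fun ν => (1 - (m ν : ℝ)) / 2) (fun _ _ => 1 / 2))) p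
      < risk r (bayesMass r idx l
        (dirichletPrior (m := m) (fun ν => (1 - (m ν : ℝ)) / 2) (fun _ _ => 1 / 2))) p := by
  have hr0 : ∀ ν, 0 < r ν := fun ν => one_pos.trans_le (hr ν)
  have eD : bayesMass r idx l
      (dirichletPrior (m := m) (fun ν => (1 - (m ν : ℝ)) / 2) (fun _ _ => 1 / 2))
      = fun x w => ENNReal.ofReal (dirichletMass r x w) := by
    funext x w
    exact bayesMass_dirichletPrior hr0 hrm x w
  have eS : bayesMass r idx l (shrinkagePrior (m := m) 1 β (fun _ => 1)
      (fun ν => (1 - (m ν : ℝ)) / 2) (fun _ _ => 1 / 2))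
      = fun x w => ENNReal.ofReal (shrinkageMass r β x w) := by
    funext x w
    exact bayesMass_shrinkagePrior hr0 hrm hβ x w
  have hD1 := le_one_of_isPredictiveMass (isPredictiveMass_dirichletPrior (l := l) hidx hr0 hrm)
    fun x w => congrFun (congrFun eD x) w
  have hS1 := le_one_of_isPredictiveMass (isPredictiveMass_shrinkagePrior (l := l) hidx hr0 hrm hβ)
    fun x w => congrFun (congrFun eS x) w
  rw [eD, eS]
  have hpos := fun x w => dirichletMass_pos (idx := idx) (l := l) hrm x w
  have hpos' := fun x w => shrinkageMass_pos (idx := idx) (l := l) hrm hβ x w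
  have hle := fun x w => dirichletMass_mul_exp_le (l := l) hidx hr0 hrm hβ x w
  have hg := gainPar_pos (idx := idx) (l := l) hrm
  obtain ⟨K, hK⟩ := exists_neg_log_dirichletMass_le (l := l) hidx hr0 hrm
  have hT1 : ∀ (x : Obs m) ν, 1 ≤ postSum r x ν := by
    intro x ν
    have := total_nonneg x ν
    have := hr ν
    unfold postSum
    linarith
  have hn : ∀ ν, (0 : ℝ) ≤ trials idx l ν := fun ν => Nat.cast_nonneg _
  set B : ℝ := ∑ ν, (trials idx l ν : ℝ) * (1 / β) with hB
  have hB0 : 0 ≤ B := Finset.sum_nonneg fun ν _ => mul_nonneg (hn ν) (by positivity)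
  have hTs : ∀ x : Obs m, 0 ≤ ∑ ν, trials idx l ν * postSum r x ν := fun x =>
    Finset.sum_nonneg fun ν _ => mul_nonneg (hn ν) (one_pos.le.trans (hT1 x ν))
  -- The gain is at least `-B`: its first terms are nonnegative, and `M₁ / T ≤ 1 / β` because `T ≥
  -- 1`. The shrinkage mass thus inherits the linear bound of the log loss.
  have hlow : ∀ x (w : Tables m idx l), Real.log (dirichletMass r x w) - B
      ≤ Real.log (shrinkageMass r β x w) := by
    intro x w
    have h1 := Real.log_le_log (mul_pos (hpos x w) (Real.exp_pos _)) (hle x w)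
    rw [Real.log_mul (hpos x w).ne' (Real.exp_pos _).ne', Real.log_exp] at h1
    have h2 : -B ≤ ∑ ν, ((expo w ν 0 : ℝ)
        * postMean r β x (fun u => u / (gainPar idx l m r ν + u))
        - trials idx l ν * (postMean r β x (fun u => u) / postSum r x ν)) := by
      rw [hB, ← Finset.sum_neg_distrib]
      refine Finset.sum_le_sum fun ν _ => ?_
      have h3 := mul_nonneg (Nat.cast_nonneg (α := ℝ) (expo w ν 0))
        (postMean_div_add_nonneg hrm hβ (hg ν) x)
      have h4 := mul_le_mul_of_nonneg_left
        ((div_le_self (postMean_id_pos hrm hβ x).le (hT1 x ν)).trans (postMean_id_le hrm hβ x)) (hn ν)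
      linarith
    linarith
  have hsum : ∀ ν, ∃ S, 0 ≤ S ∧ (1 ≤ trials idx l ν → 0 < S) ∧
      HasSum (fun x => obsMass r p x * (trials idx l ν * (zeroProb (p ν)
        * postMean r β x (fun u => u / (gainPar idx l m r ν + u))
        - postMean r β x (fun u => u) / postSum r x ν))) S := by
    intro ν
    by_cases h : 1 ≤ trials idx l ν
    · obtain ⟨S, hS, hsum⟩ := exists_hasSum_gain hr0 hrm hp hβ (hg ν) ν (hr1 ν h) (hβa ν h)
      have h1 : (0 : ℝ) < trials idx l ν := by exact_mod_cast h
      refine ⟨trials idx l ν * S, (mul_pos h1 hS).le, fun _ => mul_pos h1 hS, ?_⟩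
      simp_rw [mul_left_comm (obsMass r p _)]
      exact hsum.mul_left _
    · have h0 : trials idx l ν = 0 := by omega
      refine ⟨0, le_rfl, fun h' => absurd h' h, ?_⟩
      simp [h0, hasSum_zero]
  choose S hS0 hS1' hSs using hsum
  refine risk_lt_risk hr0 hp (b := fun x => |K| + B + ∑ ν, trials idx l ν * postSum r x ν)
    (S := ∑ ν, S ν) hpos hpos' (fun x => ?_) ?_ (fun x w => ?_) (fun x w => ?_) hle ?_ ?_
  · have := hTs x
    positivity
  · have h1 : Summable fun x => ∑ ν, trials idx l ν * (obsMass r p x * postSum r x ν) :=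
      summable_sum fun ν _ => (summable_obsMass_mul_postSum hr0 hp ν).mul_left _
    refine (((hasSum_obsMass hr0 hp).summable.mul_right (|K| + B)).add h1).congr fun x => ?_
    rw [mul_add _ (|K| + B), Finset.mul_sum]
    congr 1
    exact Finset.sum_congr rfl fun ν _ => by ring
  · rw [abs_of_nonpos (Real.log_nonpos (hpos x w).le (hD1 x w))]
    have := hK x w
    have := le_abs_self K
    linarith
  · rw [abs_of_nonpos (Real.log_nonpos (hpos' x w).le (hS1 x w))]
    have := hK x w
    have := le_abs_self K
    have := hlow x w
    linarith
  · obtain ⟨ν, hν⟩ := hex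
    exact Finset.sum_pos' (fun ν _ => hS0 ν) ⟨ν, Finset.mem_univ ν, hS1' ν hν⟩
  · refine (congrArg (fun f => HasSum f _) (funext fun x => ?_)).mp
      (hasSum_sum (s := Finset.univ) fun ν _ => hSs ν)
    rw [← Finset.mul_sum]
    congr 1
    simp_rw [Finset.mul_sum]
    rw [Finset.sum_comm]
    refine Finset.sum_congr rfl fun ν _ => ?_
    simp_rw [mul_sub, ← mul_assoc]
    -- The only dependence of the gain on `w` is the exponent of the zero cell, whose mean is
    -- `trials * zeroProb`.
    rw [Finset.sum_sub_distrib, ← Finset.sum_mul, sum_tableMass_mul_expo hidx]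
    simp_rw [mul_assoc]
    rw [← Finset.sum_mul, sum_tableMass hidx, one_mul]

end Tables

end NegMultin

/-! ### Choice of the hyperparameters and conclusion -/

theorem mainTheorem5 {N L : ℕ} (hN : 1 ≤ N) (hL : 1 ≤ L)
    (m : Fin N → ℕ) (hm : ∀ ν, 1 ≤ m ν) (r : Fin N → ℝ)
    (d : Fin L → ℕ) (hd : ∀ t, 1 ≤ d t)
    (idx : (t : Fin L) → Fin (d t) → Fin N) (hidx : ∀ t, StrictMono (idx t))
    (l : Fin L → ℕ) (hl : ∀ t, 1 ≤ l t)
    (hr : ∀ ν, 1 ≤ r ν)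
    (hrm : ∀ ν, ((m ν : ℝ) - 1) / 2 < r ν)
    (hml : ∀ ν, ∑ t ∈ NegMultin.tablesAt idx ν, (l t : ℝ) < ((m ν : ℝ) - 1) / 2) :
    NegMultin.bayesMass (m := m) r idx l (NegMultin.jeffreysPrior r)
        = NegMultin.bayesMass r idx l
            (NegMultin.dirichletPrior (fun ν => (1 - (m ν : ℝ)) / 2) (fun _ _ => 1 / 2)) ∧
      NegMultin.Inadmissible r
        (NegMultin.bayesMass (m := m) r idx l (NegMultin.jeffreysPrior r)) ∧
      ∃ (α β : ℝ) (γ : Fin N → ℝ), 0 < α ∧ 0 < β ∧ (∀ ν, 0 < γ ν) ∧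
        NegMultin.IsPredictiveMass
          (NegMultin.bayesMass (m := m) r idx l
            (NegMultin.shrinkagePrior α β γ (fun ν => (1 - (m ν : ℝ)) / 2) (fun _ _ => 1 / 2))) ∧
        NegMultin.Dominates r
          (NegMultin.bayesMass (m := m) r idx l
            (NegMultin.shrinkagePrior α β γ (fun ν => (1 - (m ν : ℝ)) / 2) (fun _ _ => 1 / 2)))
          (NegMultin.bayesMass (m := m) r idx l (NegMultin.jeffreysPrior r)) := by
  have hr0 : ∀ ν, 0 < r ν := fun ν => one_pos.trans_le (hr ν)
  have hml' : ∀ ν, (NegMultin.trials idx l ν : ℝ) < ((m ν : ℝ) - 1) / 2 := by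
    intro ν
    rw [NegMultin.trials, Nat.cast_sum]
    exact hml ν
  have hr1 : ∀ ν, 1 ≤ NegMultin.trials idx l ν → 1 < r ν := by
    intro ν hν
    have h1 : (1 : ℝ) ≤ NegMultin.trials idx l ν := by exact_mod_cast hν
    linarith [hrm ν, hml' ν]
  have hex : ∃ ν, 1 ≤ NegMultin.trials idx l ν := by
    let t : Fin L := ⟨0, hL⟩
    refine ⟨idx t ⟨0, hd t⟩, (hl t).trans ?_⟩
    exact Finset.single_le_sum (f := l) (fun _ _ => Nat.zero_le _)
      (Finset.mem_filter.2 ⟨Finset.mem_univ t, _, rfl⟩)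
  have hg := NegMultin.gainPar_pos (idx := idx) (l := l) hrm
  let C : Fin N → ℝ := fun ν => (r ν - 1) / NegMultin.gainPar idx l m r ν ^ 2
    + 1 / NegMultin.gainPar idx l m r ν
  let e : Fin N → ℝ := fun ν => (r ν - 1) / NegMultin.gainPar idx l m r ν - 1
  -- This says `r - 1 > gainPar = (1 - m) / 2 + r + trials - 1`, that is, `trials < (m - 1) / 2`.
  have he : ∀ ν, 1 ≤ NegMultin.trials idx l ν → 0 < e ν := by
    intro ν hν
    rw [sub_pos, one_lt_div (hg ν), NegMultin.gainPar, Nat.cast_sub hν, Nat.cast_one]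
    linarith [hml' ν]
  -- Larger than every `2 C / e`, so that the condition `C * (2 / β) < e` holds for all vectors with
  -- trials at once; absolute values keep `β` positive whatever the sign of `e` at the others.
  set β : ℝ := 1 + ∑ ν, |C ν * 2 / e ν| with hβdef
  have hβ : 0 < β := by positivity
  have hβa : ∀ ν, 1 ≤ NegMultin.trials idx l ν → C ν * (2 / β) < e ν := by
    intro ν hν
    have h1 : |C ν * 2 / e ν| ≤ ∑ ν, |C ν * 2 / e ν| :=
      Finset.single_le_sum (f := fun ν => |C ν * 2 / e ν|) (fun _ _ => abs_nonneg _)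
        (Finset.mem_univ ν)
    have h2 : C ν * 2 / e ν < β := by linarith [le_abs_self (C ν * 2 / e ν)]
    rw [div_lt_iff₀ (he ν hν)] at h2
    rw [← mul_div_assoc, div_lt_iff₀ hβ]
    linarith
  -- The uniform probability vectors witness that the parameter space is nonempty, which is all that
  -- the strict part of domination still needs.
  have hp : (fun ν _ => ((m ν : ℝ) + 1)⁻¹ : NegMultin.Param m) ∈ NegMultin.paramSpace m := by
    refine fun ν => ⟨fun i => by positivity, ?_⟩
    rw [Finset.sum_const, Finset.card_univ, Fintype.card_fin, nsmul_eq_mul, ← div_eq_mul_inv,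
      div_lt_one (by positivity)]
    linarith
  have hlt := fun (p : NegMultin.Param m) (hp : p ∈ NegMultin.paramSpace m) =>
    NegMultin.risk_shrinkage_lt hidx hr hrm hβ hp hr1 hex hβa
  have hS := NegMultin.isPredictiveMass_shrinkagePrior (l := l) hidx hr0 hrm hβ
  rw [NegMultin.bayesMass_jeffreysPrior hr0]
  have hdom : NegMultin.Dominates r _ _ := ⟨fun p hp => (hlt p hp).le, _, hp, hlt _ hp⟩
  exact ⟨rfl, ⟨NegMultin.isPredictiveMass_dirichletPrior hidx hr0 hrm, _, hS, hdom⟩,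
    1, β, fun _ => 1, one_pos, hβ, fun _ => one_pos, hS, hdom⟩
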